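/- Let $A\in\mathbb{Q}^{n\times n}$ be expanding (all its complex eigenvalues have modulus $>1$) and put $B=A^{-1}$; let ${}^*$ denote the transpose. For an additive subgroup $L\subset\mathbb{Q}^n$ and an invertible rational matrix $M$ write $L[M]=\bigcup_{k\ge1}(L+ML+\dots+M^{k-1}L)$ and $\mathbb{Z}^n(M)=\bigcup_{k\ge 1}(M^{-k}\mathbb{Z}^n+\dots+M^{k}\mathbb{Z}^n)$. For $M\in\{B,B^*\}$ let $b=|\mathbb{Z}^n[M]/M\mathbb{Z}^n[M]|$ and let $\nu_M(y)$ be the integer $k$ with $y\in M^k\mathbb{Z}^n[M]\setminus M^{k+1}\mathbb{Z}^n[M]$, or $\infty$ if $y$ lies in all $M^k\mathbb{Z}^n[M]$. Let $\mathbb{Z}^n((M))$ be the (Hausdorff) completion of $\mathbb{Z}^n(M)$ with respect to the distance $b^{-\nu_M(y-y')}$ (where $b^{-\infty}=0$), and let $\mathbb{K}_A=\mathbb{R}^n\times\mathbb{Z}^n((B))$. Let $\Lambda,\Gamma$ be full rank lattices with $\mathbb{Z}^n[A]\cap\mathbb{Z}^n[B]\subset\Lambda$ and $\Gamma[A^*]\cap\Gamma[B^*]\subset\Lambda^*:=\{x\in\mathbb{Z}^n\mid\langle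 x,z\rangle\in\mathbb{Z}\text{ for all }z\in\Lambda\}$. Let $\mathcal{E}\subset\mathbb{Z}^n$ be a complete set of representatives of $\mathbb{Z}^n[B]/B\mathbb{Z}^n[B]$ and $\mathcal{E}^*\subset\Gamma$ one of $\Gamma[B^*]/B^*\Gamma[B^*]$, both containing $0$. Then every $y\in\mathbb{Z}^n((B))$ has a unique expansion $y=\sum_{j}B^jy_j$ with $y_j\in\mathcal{E}$, and every $s\in\mathbb{Z}^n((B^*))$ has a unique expansion $s=\sum_{j}(B^*)^js_j$ with $s_j\in\mathcal{E}^*$, where the digits vanish for all sufficiently small $j\in\mathbb{Z}$. Put $\{y\}_B=\sum_{j<0}B^jy_j\in\mathbb{Q}^n$ and $$S_s(y)=\sum_{j\in\mathbb{Z}}\langle\{B^jy\}_B,s_j\rangle ,$$ a sum with only finitely many nonzero terms. For $r\in\mathbb{R}^n$ and $s\in\mathbb{Z}^n((B^*))$ let $$\chi_r(x)=\exp(2\pi i\langle x,r\rangle),\qquad \chi_s(y)=\exp(2\pi i S_s(y)),\qquad \chi_{r,s}(x,y)=\chi_r(x)\chi_s(y).$$ Then the characters of $\mathbb{K}_A$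 (continuous homomorphisms to the unit circle) are exactly the maps $\chi_{r,s}$ with $r\in\mathbb{R}^n$ and $s\in\mathbb{Z}^n((B^*))$. The map $(r,s)\mapsto\chi_{r,s}$ is an isomorphism of topological groups from $\mathbb{R}^n\times\mathbb{Z}^n((B^*))$ onto the Pontryagin dual of $\mathbb{K}_A$, and $s\mapsto\chi_s$ is an isomorphism of topological groups from $\mathbb{Z}^n((B^*))$ onto the Pontryagin dual of $\mathbb{Z}^n((B))$ (duals with the compact-open topology). -/

import Mathlib

open scoped Matrix

noncomputable section

namespace RationalTile

variable {n : ℕ}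

/-- The coordinatewise inclusion `ℤⁿ → ℚⁿ`. -/
def intVec (n : ℕ) : (Fin n → ℤ) →ₗ[ℤ] (Fin n → ℚ) where
  toFun z := fun i => (z i : ℚ)
  map_add' _ _ := by ext; simp
  map_smul' _ _ := by ext; simp

/-- `ℤⁿ` as a `ℤ`-submodule of `ℚⁿ`. -/
def stdLattice (n : ℕ) : Submodule ℤ (Fin n → ℚ) := LinearMap.range (intVec n)

/-- Multiplication of column vectors of `ℚⁿ` by an invertible rational matrix. -/
def act (M : GL (Fin n) ℚ) : (Fin n → ℚ) →ₗ[ℤ] (Fin n → ℚ) :=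
  (Matrix.mulVecLin (M : Matrix (Fin n) (Fin n) ℚ)).restrictScalars ℤ

/-- The transpose of an invertible rational matrix. -/
def transposeGL (M : GL (Fin n) ℚ) : GL (Fin n) ℚ where
  val := (M : Matrix (Fin n) (Fin n) ℚ)ᵀ
  inv := ((M⁻¹ : GL (Fin n) ℚ) : Matrix (Fin n) (Fin n) ℚ)ᵀ
  val_inv := by rw [← Matrix.transpose_mul, ← Units.val_mul, inv_mul_cancel]; simp
  inv_val := by rw [← Matrix.transpose_mul, ← Units.val_mul, mul_inv_cancel]; simp

/-- A rational matrix is expanding if all its complex eigenvalues lie outside the closed unit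
disc. -/
def IsExpanding (M : Matrix (Fin n) (Fin n) ℚ) : Prop :=
  ∀ z : ℂ, Module.End.HasEigenvalue (Matrix.toLin' (M.map (algebraMap ℚ ℂ))) z → 1 < ‖z‖

/-- `L[M] = ⋃ₖ (L + M L + ⋯ + Mᵏ⁻¹ L)`. -/
def poly (L : Submodule ℤ (Fin n → ℚ)) (M : GL (Fin n) ℚ) : Submodule ℤ (Fin n → ℚ) :=
  ⨆ j : ℕ, L.map (act (M ^ j))

/-- `ℤⁿ(M) = ⋃ₖ (M⁻ᵏ ℤⁿ + ⋯ + Mᵏ ℤⁿ)`. -/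
def laurent (M : GL (Fin n) ℚ) : Submodule ℤ (Fin n → ℚ) :=
  ⨆ j : ℤ, (stdLattice n).map (act (M ^ j))

/-- `Mᵏ ℤⁿ[M]` for `k ∈ ℤ`. -/
def fil (M : GL (Fin n) ℚ) (k : ℤ) : Submodule ℤ (Fin n → ℚ) :=
  (poly (stdLattice n) M).map (act (M ^ k))

/-- The order `|ℤⁿ[M] / M ℤⁿ[M]|`. -/
def residueCard (M : GL (Fin n) ℚ) : ℕ :=
  ((poly (stdLattice n) M).map (act M)).toAddSubgroup.relIndex
    (poly (stdLattice n) M).toAddSubgroup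

open Classical in
/-- The `M`-adic valuation: the `k` with `y ∈ Mᵏ ℤⁿ[M] ∖ Mᵏ⁺¹ ℤⁿ[M]` (there is at most one), and
`∞` if there is none, which for `y ∈ ℤⁿ(M)` means that `y` lies in every `Mᵏ ℤⁿ[M]`. -/
def valuation (M : GL (Fin n) ℚ) (y : Fin n → ℚ) : WithTop ℤ :=
  if h : ∃ k : ℤ, y ∈ fil M k ∧ y ∉ fil M (k + 1) then ((h.choose : ℤ) : WithTop ℤ) else ⊤

/-- `b ^ (-ν)` with the convention `b ^ (-∞) = 0`. -/
def expNeg (b : ℕ) : WithTop ℤ → ℝ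
  | ⊤ => 0
  | (k : ℤ) => (b : ℝ) ^ (-k)

/-- `|y| = b ^ (-ν(y))` for `b = |ℤⁿ[M] / M ℤⁿ[M]|`, the distance of `y` to `0`. -/
def adicNorm (M : GL (Fin n) ℚ) (y : Fin n → ℚ) : ℝ := expNeg (residueCard M) (valuation M y)

/-! Elementary facts: the function `adicNorm` is an ultrametric group seminorm on `ℤⁿ(M)`. -/

theorem act_mul (M N : GL (Fin n) ℚ) (y : Fin n → ℚ) : act (M * N) y = act M (act N y) := by
  simp [act]

theorem act_one (y : Fin n → ℚ) : act (1 : GL (Fin n) ℚ) y = y := by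
  simp [act]

theorem mem_map_act {L : Submodule ℤ (Fin n → ℚ)} {M : GL (Fin n) ℚ} {y : Fin n → ℚ} :
    y ∈ L.map (act M) ↔ act M⁻¹ y ∈ L := by
  constructor
  · rintro ⟨x, hx, rfl⟩
    rw [← act_mul, inv_mul_cancel, act_one]
    exact hx
  · intro h
    exact ⟨_, h, by rw [← act_mul, mul_inv_cancel, act_one]⟩

theorem map_act_map_act (L : Submodule ℤ (Fin n → ℚ)) (M N : GL (Fin n) ℚ) :
    (L.map (act N)).map (act M) = L.map (act (M * N)) := by
  ext y
  rw [mem_map_act, mem_map_act, mem_map_act, ← act_mul, mul_inv_rev]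

theorem act_mem_fil {M : GL (Fin n) ℚ} {y : Fin n → ℚ} (j k : ℤ) :
    act (M ^ j) y ∈ fil M (k + j) ↔ y ∈ fil M k := by
  unfold fil
  rw [mem_map_act, mem_map_act, ← act_mul, ← zpow_neg, ← zpow_neg, ← zpow_add]
  congr! 3
  ring_nf

theorem map_poly_le (L : Submodule ℤ (Fin n → ℚ)) (M : GL (Fin n) ℚ) :
    (poly L M).map (act M) ≤ poly L M := by
  unfold poly
  rw [Submodule.map_iSup]
  refine iSup_le fun j => ?_
  rw [map_act_map_act, ← pow_succ']
  exact le_iSup (fun j : ℕ => L.map (act (M ^ j))) (j + 1)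

theorem poly_eq_sup (L : Submodule ℤ (Fin n → ℚ)) (M : GL (Fin n) ℚ) :
    poly L M = L ⊔ (poly L M).map (act M) := by
  apply le_antisymm
  · conv_lhs => unfold poly
    refine iSup_le fun j => ?_
    cases j with
    | zero =>
      refine le_trans ?_ le_sup_left
      rintro _ ⟨x, hx, rfl⟩
      rw [pow_zero, act_one]
      exact hx
    | succ j =>
      refine le_trans ?_ le_sup_right
      rw [pow_succ', ← map_act_map_act]
      exact Submodule.map_mono (le_iSup (fun j : ℕ => L.map (act (M ^ j))) j)
  · refine sup_le ?_ (map_poly_le L M)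
    intro x hx
    refine (le_iSup (fun j : ℕ => L.map (act (M ^ j))) 0) ⟨x, hx, ?_⟩
    rw [pow_zero, act_one]

theorem fil_succ_le (M : GL (Fin n) ℚ) (k : ℤ) : fil M (k + 1) ≤ fil M k := by
  unfold fil
  rw [zpow_add_one, ← map_act_map_act]
  exact Submodule.map_mono (map_poly_le _ M)

theorem fil_antitone (M : GL (Fin n) ℚ) : Antitone (fil M) :=
  antitone_int_of_succ_le (fil_succ_le M)

theorem exists_mem_fil {M : GL (Fin n) ℚ} {y : Fin n → ℚ} (hy : y ∈ laurent M) :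
    ∃ k, y ∈ fil M k := by
  have h : laurent M ≤ ⨆ k, fil M k := by
    refine iSup_mono fun j => Submodule.map_mono ?_
    rw [poly_eq_sup]
    exact le_sup_left
  have hd : Directed (· ≤ ·) (fil M) := by
    intro i j
    exact ⟨min i j, fil_antitone M (min_le_left _ _), fil_antitone M (min_le_right _ _)⟩
  exact (Submodule.mem_iSup_of_directed _ hd).1 (h hy)

theorem valuation_eq {M : GL (Fin n) ℚ} {y : Fin n → ℚ} {k : ℤ} (h1 : y ∈ fil M k)
    (h2 : y ∉ fil M (k + 1)) : valuation M y = k := by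
  have h : ∃ k : ℤ, y ∈ fil M k ∧ y ∉ fil M (k + 1) := ⟨k, h1, h2⟩
  unfold valuation
  rw [dif_pos h]
  obtain ⟨h3, h4⟩ := h.choose_spec
  congr 1
  apply le_antisymm
  · by_contra! hlt
    exact h2 (fil_antitone M (by omega) h3)
  · by_contra! hlt
    exact h4 (fil_antitone M (by omega) h1)

theorem valuation_eq_coe_iff {M : GL (Fin n) ℚ} {y : Fin n → ℚ} {k : ℤ} :
    valuation M y = k ↔ y ∈ fil M k ∧ y ∉ fil M (k + 1) := by
  refine ⟨fun h => ?_, fun h => valuation_eq h.1 h.2⟩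
  by_cases hex : ∃ k : ℤ, y ∈ fil M k ∧ y ∉ fil M (k + 1)
  · obtain ⟨l, hl⟩ := hex
    have := valuation_eq hl.1 hl.2
    rw [h] at this
    obtain rfl : k = l := by exact_mod_cast this
    exact hl
  · unfold valuation at h
    rw [dif_neg hex] at h
    exact absurd h (WithTop.coe_ne_top).symm

theorem exists_valuation_le {M : GL (Fin n) ℚ} {y : Fin n → ℚ} {m : ℤ} (hy : y ∈ laurent M)
    (hm : y ∉ fil M (m + 1)) : ∃ k ≤ m, valuation M y = k := by
  obtain ⟨k₀, hk₀⟩ := exists_mem_fil hy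
  have hb : ∀ k : ℤ, y ∈ fil M k → k ≤ m := by
    intro k hk
    by_contra! hlt
    exact hm (fil_antitone M (by omega) hk)
  obtain ⟨k, hk, hmax⟩ := Int.exists_greatest_of_bdd (P := fun k => y ∈ fil M k) ⟨m, hb⟩ ⟨k₀, hk₀⟩
  refine ⟨k, hb k hk, valuation_eq hk fun h => ?_⟩
  have := hmax _ h
  omega

theorem exists_nsmul_mem (M : GL (Fin n) ℚ) :
    ∃ N : ℕ, N ≠ 0 ∧ ∀ x ∈ stdLattice n, (N : ℤ) • x ∈ (stdLattice n).map (act M) := by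
  let P : Matrix (Fin n) (Fin n) ℚ := ((M⁻¹ : GL (Fin n) ℚ) : Matrix (Fin n) (Fin n) ℚ)
  let N : ℕ := ∏ i, ∏ j, (P i j).den
  have hN : ∀ i j, ∃ c : ℤ, (N : ℚ) * P i j = c := by
    intro i j
    have h1 : (P i j).den ∣ N :=
      (Finset.dvd_prod_of_mem (fun j => (P i j).den) (Finset.mem_univ j)).trans
        (Finset.dvd_prod_of_mem (fun i => ∏ j, (P i j).den) (Finset.mem_univ i))
    obtain ⟨c, hc⟩ := h1
    refine ⟨c * (P i j).num, ?_⟩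
    rw [hc]
    push_cast
    have := Rat.mul_den_eq_num (P i j)
    linear_combination (c : ℚ) * this
  choose c hc using hN
  refine ⟨N, ?_, ?_⟩
  · exact Finset.prod_ne_zero_iff.2 fun i _ => Finset.prod_ne_zero_iff.2 fun j _ => (P i j).den_nz
  · rintro _ ⟨z, rfl⟩
    rw [mem_map_act]
    refine ⟨fun i => ∑ j, c i j * z j, ?_⟩
    ext i
    simp only [intVec, act, LinearMap.coe_mk, AddHom.coe_mk, map_smul, Pi.smul_apply,
      LinearMap.coe_restrictScalars, Matrix.mulVecLin_apply, Matrix.mulVec, dotProduct]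
    push_cast
    rw [zsmul_eq_mul, Finset.mul_sum]
    refine Finset.sum_congr rfl fun j _ => ?_
    rw [← hc]
    simp only [P, Matrix.coe_units_inv]
    push_cast
    ring

theorem residueCard_ne_zero (M : GL (Fin n) ℚ) : residueCard M ≠ 0 := by
  unfold residueCard
  set H := (poly (stdLattice n) M).map (act M) with hH
  have h1 : (poly (stdLattice n) M).toAddSubgroup
      = (stdLattice n).toAddSubgroup ⊔ H.toAddSubgroup := by
    conv_lhs => rw [poly_eq_sup]
    exact Submodule.sup_toAddSubgroup _ _
  rw [h1, AddSubgroup.relIndex_sup_right]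
  obtain ⟨N, hN0, hN⟩ := exists_nsmul_mem M
  have : Module.Finite ℤ (stdLattice n) := by
    unfold stdLattice
    infer_instance
  have hfin : Finite (stdLattice n ⧸ H.submoduleOf (stdLattice n)) := by
    refine Module.finite_of_fg_torsion _ fun q => ?_
    obtain ⟨x, rfl⟩ := Submodule.Quotient.mk_surjective _ q
    refine ⟨⟨(N : ℤ), mem_nonZeroDivisors_of_ne_zero (by exact_mod_cast hN0)⟩, ?_⟩
    rw [Submonoid.mk_smul, ← Submodule.Quotient.mk_smul, Submodule.Quotient.mk_eq_zero]
    refine Submodule.map_mono ?_ (hN x x.2)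
    conv_rhs => rw [poly_eq_sup]
    exact le_sup_left
  exact (Nat.card_pos (α := stdLattice n ⧸ H.submoduleOf (stdLattice n))).ne'

theorem one_le_residueCard (M : GL (Fin n) ℚ) : (1 : ℝ) ≤ residueCard M := by
  exact_mod_cast Nat.one_le_iff_ne_zero.2 (residueCard_ne_zero M)

theorem expNeg_nonneg (b : ℕ) (v : WithTop ℤ) : 0 ≤ expNeg b v := by
  cases v with
  | top => exact le_rfl
  | coe k => exact zpow_nonneg (Nat.cast_nonneg b) _

theorem adicNorm_zero (M : GL (Fin n) ℚ) : adicNorm M 0 = 0 := by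
  have h : valuation M (0 : Fin n → ℚ) = ⊤ := by
    unfold valuation
    rw [dif_neg]
    rintro ⟨k, -, h⟩
    exact h (Submodule.zero_mem _)
  unfold adicNorm
  rw [h]
  rfl

theorem adicNorm_neg (M : GL (Fin n) ℚ) (y : Fin n → ℚ) : adicNorm M (-y) = adicNorm M y := by
  have h : valuation M (-y) = valuation M y := by
    by_cases hex : ∃ k : ℤ, y ∈ fil M k ∧ y ∉ fil M (k + 1)
    · obtain ⟨k, h1, h2⟩ := hex
      rw [valuation_eq h1 h2]
      exact valuation_eq (neg_mem h1) fun h => h2 (neg_mem_iff.1 h)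
    · have hex' : ¬ ∃ k : ℤ, -y ∈ fil M k ∧ -y ∉ fil M (k + 1) := by
        simpa only [neg_mem_iff] using hex
      unfold valuation
      rw [dif_neg hex, dif_neg hex']
  unfold adicNorm
  rw [h]

theorem adicNorm_add_le_max {M : GL (Fin n) ℚ} {x y : Fin n → ℚ} (hx : x ∈ laurent M)
    (hy : y ∈ laurent M) : adicNorm M (x + y) ≤ max (adicNorm M x) (adicNorm M y) := by
  have key : ∀ {z : Fin n → ℚ} {m : ℤ}, z ∈ laurent M → z ∉ fil M (m + 1) →
      expNeg (residueCard M) m ≤ adicNorm M z := by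
    intro z m hz hm
    obtain ⟨k, hk, hv⟩ := exists_valuation_le hz hm
    unfold adicNorm
    rw [hv]
    exact zpow_le_zpow_right₀ (one_le_residueCard M) (by omega)
  rcases h : valuation M (x + y) with _ | m
  · have h0 : adicNorm M (x + y) = 0 := by
      unfold adicNorm
      rw [h]
      rfl
    rw [h0]
    exact le_max_of_le_left (expNeg_nonneg _ _)
  · have h' := (valuation_eq_coe_iff (k := m)).1 h
    have hm : adicNorm M (x + y) = expNeg (residueCard M) m := by
      unfold adicNorm
      rw [h]
      rfl
    rw [hm]
    by_cases hxm : x ∈ fil M (m + 1)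
    · by_cases hym : y ∈ fil M (m + 1)
      · exact absurd (Submodule.add_mem _ hxm hym) h'.2
      · exact le_max_of_le_right (key hy hym)
    · exact le_max_of_le_left (key hx hxm)

theorem valuation_act (M : GL (Fin n) ℚ) (j : ℤ) (y : Fin n → ℚ) :
    valuation M (act (M ^ j) y) = valuation M y + j := by
  by_cases hex : ∃ k : ℤ, y ∈ fil M k ∧ y ∉ fil M (k + 1)
  · obtain ⟨k, h1, h2⟩ := hex
    rw [valuation_eq h1 h2, ← WithTop.coe_add]
    refine valuation_eq ((act_mem_fil j k).2 h1) fun h => h2 ?_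
    rw [show k + j + 1 = (k + 1) + j by ring] at h
    exact (act_mem_fil j (k + 1)).1 h
  · have hex' : ¬ ∃ k : ℤ, act (M ^ j) y ∈ fil M k ∧ act (M ^ j) y ∉ fil M (k + 1) := by
      rintro ⟨k, h1, h2⟩
      refine hex ⟨k - j, (act_mem_fil j (k - j)).1 ?_, fun h => h2 ?_⟩
      · rwa [sub_add_cancel]
      · have := (act_mem_fil j (k - j + 1)).2 h
        rwa [show k - j + 1 + j = k + 1 by ring] at this
    unfold valuation
    rw [dif_neg hex, dif_neg hex', WithTop.top_add]

theorem adicNorm_act (M : GL (Fin n) ℚ) (j : ℤ) (y : Fin n → ℚ) :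
    adicNorm M (act (M ^ j) y) = (residueCard M : ℝ) ^ (-j) * adicNorm M y := by
  have hb : (residueCard M : ℝ) ≠ 0 := Nat.cast_ne_zero.2 (residueCard_ne_zero M)
  unfold adicNorm
  rw [valuation_act]
  rcases valuation M y with _ | k
  · exact (mul_zero _).symm
  · change (residueCard M : ℝ) ^ (-(k + j)) = (residueCard M : ℝ) ^ (-j) * (residueCard M : ℝ) ^ (-k)
    rw [← zpow_add₀ hb]
    ring_nf

theorem act_mem_laurent {M : GL (Fin n) ℚ} (j : ℤ) {y : Fin n → ℚ} (hy : y ∈ laurent M) :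
    act (M ^ j) y ∈ laurent M := by
  have h : (laurent M).map (act (M ^ j)) ≤ laurent M := by
    unfold laurent
    rw [Submodule.map_iSup]
    refine iSup_le fun i => ?_
    rw [map_act_map_act, ← zpow_add]
    exact le_iSup (fun j : ℤ => (stdLattice n).map (act (M ^ j))) (j + i)
  exact h ⟨y, hy, rfl⟩

theorem act_intVec_mem_laurent (M : GL (Fin n) ℚ) (j : ℤ) (z : Fin n → ℤ) :
    act (M ^ j) (intVec n z) ∈ laurent M :=
  (le_iSup (fun j : ℤ => (stdLattice n).map (act (M ^ j))) j) ⟨_, ⟨z, rfl⟩, rfl⟩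

/-! The completion `ℤⁿ((M))`. -/

/-- `ℤⁿ(M)` as a type of its own, to carry the `M`-adic metric (and not the one of `ℚⁿ`). -/
def LaurentGroup (M : GL (Fin n) ℚ) : Type := ↥(laurent M)

instance (M : GL (Fin n) ℚ) : AddCommGroup (LaurentGroup M) :=
  inferInstanceAs (AddCommGroup ↥(laurent M))

/-- The `M`-adic distance `d(y, y') = b ^ (-ν(y - y'))` on `ℤⁿ(M)`. -/
instance (M : GL (Fin n) ℚ) : SeminormedAddCommGroup (LaurentGroup M) :=
  AddGroupSeminorm.toSeminormedAddCommGroup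
    { toFun := fun y : LaurentGroup M => adicNorm M y.1
      map_zero' := adicNorm_zero M
      add_le' := fun x y => (adicNorm_add_le_max x.2 y.2).trans
        (max_le_add_of_nonneg (expNeg_nonneg _ _) (expNeg_nonneg _ _))
      neg' := fun y => adicNorm_neg M y.1 }

/-- The space `ℤⁿ((M))`: the (Hausdorff) completion of `ℤⁿ(M)` for the `M`-adic distance. -/
abbrev Series (M : GL (Fin n) ℚ) : Type := UniformSpace.Completion (LaurentGroup M)

/-- Multiplication by `Mʲ` on `ℤⁿ(M)`. -/
def laurentMul (M : GL (Fin n) ℚ) (j : ℤ) : LaurentGroup M →+ LaurentGroup M where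
  toFun y := ⟨act (M ^ j) y.1, act_mem_laurent j y.2⟩
  map_zero' := Subtype.ext (map_zero (act (M ^ j)))
  map_add' x y := Subtype.ext (map_add (act (M ^ j)) x.1 y.1)

theorem continuous_laurentMul (M : GL (Fin n) ℚ) (j : ℤ) : Continuous (laurentMul M j) :=
  AddMonoidHomClass.continuous_of_bound (laurentMul M j) ((residueCard M : ℝ) ^ (-j))
    fun y => (adicNorm_act M j y.1).le

/-- Multiplication by `Mʲ` on `ℤⁿ((M))`, the continuous extension of that on `ℤⁿ(M)`. -/
def seriesMul (M : GL (Fin n) ℚ) (j : ℤ) : Series M →+ Series M :=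
  (laurentMul M j).completion (continuous_laurentMul M j)

/-- The monomial `Mʲ z` with `z ∈ ℤⁿ`, as an element of `ℤⁿ((M))`. -/
def monomial (M : GL (Fin n) ℚ) (j : ℤ) (z : Fin n → ℤ) : Series M :=
  UniformSpace.Completion.coe' (α := LaurentGroup M)
    ⟨act (M ^ j) (intVec n z), act_intVec_mem_laurent M j z⟩

/-! Digit expansions and fractional parts. -/

/-- `E ⊆ L ∩ ℤⁿ` is a complete set of representatives of `L[M] / M L[M]` that contains `0`. -/
def IsResidueSystem (L : Submodule ℤ (Fin n → ℚ)) (M : GL (Fin n) ℚ) (E : Set (Fin n → ℤ)) :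
    Prop :=
  (∀ e ∈ E, intVec n e ∈ L) ∧ 0 ∈ E ∧
    ∀ x ∈ poly L M, ∃! e, e ∈ E ∧ x - intVec n e ∈ (poly L M).map (act M)

/-- `y = ∑ⱼ Mʲ dⱼ` in `ℤⁿ((M))`, with digits `dⱼ ∈ E` that vanish for all small `j`. -/
def IsExpansion (M : GL (Fin n) ℚ) (E : Set (Fin n → ℤ)) (y : Series M) (d : ℤ → Fin n → ℤ) :
    Prop :=
  (∀ j, d j ∈ E) ∧ (∃ N : ℤ, ∀ j < N, d j = 0) ∧ HasSum (fun j : ℤ => monomial M j (d j)) y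

open Classical in
/-- The digits of the `M`-adic expansion of `y` with digits in `E`. -/
def digits (M : GL (Fin n) ℚ) (E : Set (Fin n → ℤ)) (y : Series M) : ℤ → Fin n → ℤ :=
  if h : ∃ d, IsExpansion M E y d then h.choose else 0

/-- The fractional part `{y} = ∑_{j < 0} Mʲ dⱼ ∈ ℚⁿ`, where the `dⱼ` are the digits of `y`. -/
def fracPart (M : GL (Fin n) ℚ) (E : Set (Fin n → ℤ)) (y : Series M) : Fin n → ℚ :=
  ∑ᶠ (j : ℤ) (_ : j < 0), act (M ^ j) (intVec n (digits M E y j))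

/-- The dual lattice `Λ* = {x ∈ ℤⁿ | ⟨x, z⟩ ∈ ℤ for all z ∈ Λ}`. -/
def dualLattice (L : Submodule ℤ (Fin n → ℚ)) : Submodule ℤ (Fin n → ℚ) where
  carrier := {x | x ∈ stdLattice n ∧ ∀ z ∈ L, ∃ m : ℤ, x ⬝ᵥ z = m}
  zero_mem' := ⟨Submodule.zero_mem _, fun z _ => ⟨0, by simp⟩⟩
  add_mem' := by
    rintro x y ⟨hx, hx'⟩ ⟨hy, hy'⟩
    refine ⟨Submodule.add_mem _ hx hy, fun z hz => ?_⟩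
    obtain ⟨k, hk⟩ := hx' z hz
    obtain ⟨l, hl⟩ := hy' z hz
    exact ⟨k + l, by rw [add_dotProduct, hk, hl]; push_cast; rfl⟩
  smul_mem' := by
    rintro c x ⟨hx, hx'⟩
    refine ⟨Submodule.smul_mem _ c hx, fun z hz => ?_⟩
    obtain ⟨k, hk⟩ := hx' z hz
    exact ⟨c * k, by rw [smul_dotProduct, hk, zsmul_eq_mul]; push_cast; rfl⟩

/-! The representation space of `A` and its characters. With `B = A⁻¹` and `B* = Bᵀ`, the digit
sets are `E ⊆ ℤⁿ` for `B` and `F ⊆ Γ ⊆ ℤⁿ` for `B*`. -/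

/-- The representation space `ℝⁿ × ℤⁿ((A⁻¹))`. -/
abbrev RepSpace (A : GL (Fin n) ℚ) : Type := EuclideanSpace ℝ (Fin n) × Series A⁻¹

/-- `S_s(y) = ∑ⱼ ⟨{Bʲ y}, sⱼ⟩`, where `s = ∑ⱼ (B*)ʲ sⱼ` with `sⱼ ∈ F`. -/
def pairing (B : GL (Fin n) ℚ) (E F : Set (Fin n → ℤ)) (s : Series (transposeGL B))
    (y : Series B) : ℚ :=
  ∑ᶠ j : ℤ, fracPart B E (seriesMul B j y) ⬝ᵥ intVec n (digits (transposeGL B) F s j)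

/-- `χ_r(x) = exp(2πi⟨x, r⟩)` on `ℝⁿ`. -/
def realChar (r x : EuclideanSpace ℝ (Fin n)) : Circle :=
  Circle.exp (2 * Real.pi * inner ℝ x r)

/-- `χ_s(y) = exp(2πi S_s(y))` on `ℤⁿ((B))`. -/
def adicChar (B : GL (Fin n) ℚ) (E F : Set (Fin n → ℤ)) (s : Series (transposeGL B))
    (y : Series B) : Circle :=
  Circle.exp (2 * Real.pi * (pairing B E F s y : ℝ))

/-- A character of an additive topological group: a continuous map `χ` to the unit circle with
`χ(x + y) = χ(x) χ(y)`. -/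
def IsCharacter {G : Type*} [AddCommGroup G] [TopologicalSpace G] (χ : G → Circle) : Prop :=
  Continuous χ ∧ ∀ x y, χ (x + y) = χ x * χ y

end RationalTile

end

noncomputable section

namespace RationalTile

variable {n : ℕ}

open Filter Topology UniformSpace

/-! Put `B = A⁻¹`. Filter `ℤⁿ((B))` by the closures `U_k` of `Bᵏ ℤⁿ[B]`, which are compact open
subgroups, and `ℤⁿ((B*))` by the analogous `U'_l`. The duality of the adic factors rests on four
properties of `χ_s(y)`, collected in `IsDualPairing`: it is multiplicative in both variables; it is
trivial on `U'_l × U_k` once `k + l` exceeds a constant; triviality of `χ_s` on `U_k` forces `s ∈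
U'_{-k}`; the `χ_s` separate points. Given these, compactness of `U_k` and the fact that each `χ_s`
takes finitely many values on it show that every continuous character agrees on `U_k` with some
`χ_s` (`exists_eqOn`). As `U_k` grows, these `s` form a Cauchy sequence, and its limit represents
the character (`exists_eq`). The comparison of the filtrations makes the bijection a homeomorphism.

The arithmetic input is that `{y}` is determined, modulo `ℤⁿ[B⁻¹] ∩ ℤⁿ[B]`, by lying in `ℤⁿ[B⁻¹]`
and being congruent to `y` modulo `U_0` (`sub_fracPart_mem`). Through `Λ` the hypotheses make this
intersection pair integrally with `Γ[B*⁻¹] ∩ Γ[B*]`, so carries between digits disappear under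
`exp(2πi ·)`. This gives the mirror formulas `χ_s(Bᵏz) = exp(2πi⟨z, {(B*)ᵏ s}⟩)` and `χ_{(B*)ʲγ}(y)
= exp(2πi⟨{Bʲy}, γ⟩)` (`char_monomial_right`, `char_monomial_left`), from which the four properties
follow.

The digits of `s` lie in `Γ`, while the metric is defined by `ℤⁿ`; `IsFullSublattice.exists_shift`
shows that the two filtrations differ by a bounded shift. For `ℝⁿ`, characters are lifted through
the covering `ℝ → 𝕋` and become linear functionals. The product then follows formally. -/

/-! ### Subgroups of `ℚⁿ` and the filtrations `Mᵏ L[M]`. -/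

/-- `P` need not be finitely generated, so cosets are counted locally: lifts of finitely many cosets
span a free group of rank at most `n`, and coordinates modulo `N` separate the cosets. Hence there
are at most `N ^ n` of them. -/
theorem finite_quotient_of_smul_mem {P G : Submodule ℤ (Fin n → ℚ)} {N : ℕ} (hN : N ≠ 0)
    (h : ∀ x ∈ P, (N : ℤ) • x ∈ G) : Finite (P ⧸ G.submoduleOf P) := by
  by_contra hinf
  rw [not_finite_iff_infinite] at hinf
  obtain ⟨S, hS⟩ := Infinite.exists_subset_card_eq (P ⧸ G.submoduleOf P) (N ^ n + 1)
  let f : (P ⧸ G.submoduleOf P) → P := Quotient.out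
  have hf : ∀ q, Submodule.Quotient.mk (f q) = q := fun q => Quotient.out_eq q
  let Q : Submodule ℤ P := Submodule.span ℤ (S.image f : Finset P)
  have : Module.Finite ℤ Q := Module.Finite.span_finset ℤ _
  let b := Module.finBasis ℤ Q
  set r := Module.finrank ℤ Q
  have hr : r ≤ n := by
    have h1 : LinearIndependent ℤ (fun i => ((b i : P) : Fin n → ℚ)) :=
      (b.linearIndependent.map' Q.subtype (Submodule.ker_subtype _)).map' P.subtype
        (Submodule.ker_subtype _)
    have h2 := (LinearIndependent.iff_fractionRing ℤ ℚ).1 h1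
    simpa using h2.fintype_card_le_finrank
  have hmem : ∀ s : S, f s ∈ Q := fun s =>
    Submodule.subset_span (Finset.mem_coe.2 (Finset.mem_image_of_mem f s.2))
  have : NeZero N := ⟨hN⟩
  let g : S → (Fin r → ZMod N) := fun s i => ((b.repr ⟨f s, hmem s⟩ i : ℤ) : ZMod N)
  have hg : Function.Injective g := by
    intro s t hst
    have hdvd : ∀ i, ∃ c : ℤ, b.repr (⟨f s, hmem s⟩ - ⟨f t, hmem t⟩) i = N * c := by
      intro i
      have := congrFun hst i
      rw [← sub_eq_zero, ← Int.cast_sub, ZMod.intCast_zmod_eq_zero_iff_dvd] at this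
      obtain ⟨c, hc⟩ := this
      exact ⟨c, by simpa using hc⟩
    choose c hc using hdvd
    have hq : (⟨f s, hmem s⟩ - ⟨f t, hmem t⟩ : Q) = (N : ℤ) • ∑ i, c i • b i := by
      rw [← b.sum_repr (⟨f s, hmem s⟩ - ⟨f t, hmem t⟩ : Q), Finset.smul_sum]
      refine Finset.sum_congr rfl fun i _ => ?_
      rw [hc, mul_smul]
    have hp : f s - f t = (N : ℤ) • ((∑ i, c i • b i : Q) : P) := congrArg Subtype.val hq
    apply Subtype.ext
    rw [← hf s, ← hf t, Submodule.Quotient.eq, hp]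
    exact h _ (Subtype.property _)
  have hc := Fintype.card_le_of_injective g hg
  rw [Fintype.card_coe, hS, Fintype.card_fun, ZMod.card, Fintype.card_fin] at hc
  have := Nat.pow_le_pow_right (Nat.pos_of_ne_zero hN) hr
  omega

/-- `Mᵏ L[M]` for `k ∈ ℤ`. -/
def gfil (L : Submodule ℤ (Fin n → ℚ)) (M : GL (Fin n) ℚ) (k : ℤ) : Submodule ℤ (Fin n → ℚ) :=
  (poly L M).map (act (M ^ k))

theorem gfil_zero (L : Submodule ℤ (Fin n → ℚ)) (M : GL (Fin n) ℚ) : gfil L M 0 = poly L M := by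
  ext y
  rw [gfil, mem_map_act, zpow_zero, inv_one, act_one]

theorem gfil_one (L : Submodule ℤ (Fin n → ℚ)) (M : GL (Fin n) ℚ) :
    gfil L M 1 = (poly L M).map (act M) := by
  rw [gfil, zpow_one]

theorem act_mem_gfil {L : Submodule ℤ (Fin n → ℚ)} {M : GL (Fin n) ℚ} {y : Fin n → ℚ} (j k : ℤ) :
    act (M ^ j) y ∈ gfil L M (k + j) ↔ y ∈ gfil L M k := by
  unfold gfil
  rw [mem_map_act, mem_map_act, ← act_mul, ← zpow_neg, ← zpow_neg, ← zpow_add]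
  congr! 3
  ring_nf

theorem gfil_antitone (L : Submodule ℤ (Fin n → ℚ)) (M : GL (Fin n) ℚ) : Antitone (gfil L M) := by
  refine antitone_int_of_succ_le fun k => ?_
  unfold gfil
  rw [zpow_add_one, ← map_act_map_act]
  exact Submodule.map_mono (map_poly_le _ M)

theorem poly_mono {L L' : Submodule ℤ (Fin n → ℚ)} (h : L ≤ L') (M : GL (Fin n) ℚ) :
    poly L M ≤ poly L' M :=
  iSup_mono fun _ => Submodule.map_mono h

theorem gfil_mono {L L' : Submodule ℤ (Fin n → ℚ)} (h : L ≤ L') (M : GL (Fin n) ℚ) (k : ℤ) :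
    gfil L M k ≤ gfil L' M k :=
  Submodule.map_mono (poly_mono h M)

theorem le_poly (L : Submodule ℤ (Fin n → ℚ)) (M : GL (Fin n) ℚ) : L ≤ poly L M := by
  conv_rhs => rw [poly_eq_sup]
  exact le_sup_left

theorem poly_le_laurent (M : GL (Fin n) ℚ) : poly (stdLattice n) M ≤ laurent M :=
  iSup_le fun j => by
    rw [← zpow_natCast]
    exact le_iSup (fun j : ℤ => (stdLattice n).map (act (M ^ j))) j

theorem fil_le_laurent (M : GL (Fin n) ℚ) (k : ℤ) : fil M k ≤ laurent M := by
  rintro _ ⟨x, hx, rfl⟩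
  exact act_mem_laurent k (poly_le_laurent M hx)

theorem smul_mem_poly {L : Submodule ℤ (Fin n → ℚ)} {N : ℕ}
    (h : ∀ x ∈ stdLattice n, (N : ℤ) • x ∈ L) (M : GL (Fin n) ℚ) :
    ∀ x ∈ poly (stdLattice n) M, (N : ℤ) • x ∈ poly L M := by
  intro x hx
  have : poly (stdLattice n) M ≤ (poly L M).comap (LinearMap.lsmul ℤ (Fin n → ℚ) (N : ℤ)) := by
    refine iSup_le fun j => ?_
    rintro _ ⟨z, hz, rfl⟩
    exact (le_iSup (fun j : ℕ => L.map (act (M ^ j))) j) ⟨_, h z hz, map_smul _ _ _⟩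
  exact this hx

theorem act_pow_mem_poly {L : Submodule ℤ (Fin n → ℚ)} {M : GL (Fin n) ℚ} {x : Fin n → ℚ}
    (j : ℕ) (hx : x ∈ poly L M) : act (M ^ j) x ∈ poly L M := by
  induction j with
  | zero => rwa [pow_zero, act_one]
  | succ j ih =>
    rw [pow_succ', act_mul]
    exact map_poly_le L M ⟨_, ih, rfl⟩

/-- A sublattice of `ℤⁿ` of finite index. -/
structure IsFullSublattice (L : Submodule ℤ (Fin n → ℚ)) : Prop where
  le_std : L ≤ stdLattice n
  exists_smul : ∃ N : ℕ, N ≠ 0 ∧ ∀ x ∈ stdLattice n, (N : ℤ) • x ∈ L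

theorem isFullSublattice_std : IsFullSublattice (stdLattice n) :=
  ⟨le_rfl, 1, one_ne_zero, fun x hx => by simpa using hx⟩

/-- Multiplication by `M` on `ℤⁿ[M] / L[M]`. -/
def quotientMul {L : Submodule ℤ (Fin n → ℚ)} (M : GL (Fin n) ℚ) :
    Module.End ℤ (poly (stdLattice n) M ⧸ (poly L M).submoduleOf (poly (stdLattice n) M)) :=
  Submodule.mapQ _ _
    ((act M).restrict fun x hx => map_poly_le (stdLattice n) M ⟨x, hx, rfl⟩)
    fun x hx => map_poly_le L M ⟨x.1, hx, rfl⟩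

theorem quotientMul_pow_mk {L : Submodule ℤ (Fin n → ℚ)} (M : GL (Fin n) ℚ) (j : ℕ)
    (x : poly (stdLattice n) M) :
    (quotientMul (L := L) M ^ j) (Submodule.Quotient.mk x) =
      Submodule.Quotient.mk ⟨act (M ^ j) x.1, act_pow_mem_poly j x.2⟩ := by
  induction j with
  | zero => simp [act_one]
  | succ j ih =>
    rw [pow_succ', Module.End.mul_apply, ih]
    simp only [pow_succ', act_mul]
    rfl

/-- `L(M) ∩ Mᵏ ℤⁿ[M] ⊆ Mᵏ⁻ᵐ L[M]` and `Mᵏ ℤⁿ[M] ⊆ Mᵏ⁻ᵐ L[M] + Mˡ ℤⁿ[M]`, with `m` independent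
of `k` and `l`. -/
theorem IsFullSublattice.exists_shift {L : Submodule ℤ (Fin n → ℚ)} (hL : IsFullSublattice L)
    (M : GL (Fin n) ℚ) :
    ∃ m : ℕ, (∀ (j k : ℤ) (x : Fin n → ℚ), x ∈ gfil L M j → x ∈ fil M k → x ∈ gfil L M (k - m)) ∧
      ∀ (k l : ℤ) (x : Fin n → ℚ), x ∈ fil M k → ∃ g ∈ gfil L M (k - m), x - g ∈ fil M l := by
  obtain ⟨N, hN, hNL⟩ := hL.exists_smul
  have hfin : Finite (poly (stdLattice n) M ⧸ (poly L M).submoduleOf (poly (stdLattice n) M)) :=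
    finite_quotient_of_smul_mem hN (smul_mem_poly hNL M)
  set T := quotientMul (L := L) M
  -- On the finite group `ℤⁿ[M] / L[M]` the kernels and the ranges of the powers of multiplication
  -- by `M` stabilise; `m` serves for both.
  obtain ⟨m₁, h₁⟩ := Filter.eventually_atTop.1 T.eventually_iSup_ker_pow_eq
  obtain ⟨m₂, h₂⟩ := Filter.eventually_atTop.1 T.eventually_iInf_range_pow_eq
  set m := max m₁ m₂
  have hker := h₁ m (le_max_left _ _)
  have hran := h₂ m (le_max_right _ _)
  have hmk : ∀ (j : ℕ) (x : Fin n → ℚ) (hx : x ∈ poly (stdLattice n) M),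
      (T ^ j) (Submodule.Quotient.mk ⟨x, hx⟩) = 0 ↔ act (M ^ j) x ∈ poly L M := by
    intro j x hx
    rw [quotientMul_pow_mk, Submodule.Quotient.mk_eq_zero]
    rfl
  refine ⟨m, fun j k x hxj hxk => ?_, fun k l x hx => ?_⟩
  · obtain ⟨p, hp, rfl⟩ := hxk
    -- Writing `x = Mᵏ p`, membership of `x` in `Mʲ L[M]` says that some power of `M` kills the
    -- class of `p`. Then `Mᵐ` kills it already.
    have hj : act (M ^ (j - k).natAbs) p ∈ poly L M := by
      rw [← gfil_zero, ← zpow_natCast]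
      have h1 : p ∈ gfil L M (j - k) := by
        rw [← act_mem_gfil k, sub_add_cancel]
        exact hxj
      have h2 := (act_mem_gfil ((j - k).natAbs : ℤ) (j - k)).2 h1
      exact gfil_antitone L M (by omega) h2
    rw [← hmk _ _ hp] at hj
    have h3 : (T ^ m) (Submodule.Quotient.mk ⟨p, hp⟩) = 0 := by
      rw [← LinearMap.mem_ker, ← hker]
      exact (le_iSup (fun j => LinearMap.ker (T ^ j)) _) (LinearMap.mem_ker.2 hj)
    rw [hmk, ← gfil_zero, ← zpow_natCast] at h3
    rw [show k - m = -m + k by ring, act_mem_gfil k, ← act_mem_gfil (m : ℤ), neg_add_cancel]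
    exact h3
  · obtain ⟨p, hp, rfl⟩ := hx
    -- The range of `Tᵐ` equals that of a power so high that the remainder `M^(k + |l - k|) q` falls
    -- into `Mˡ ℤⁿ[M]`.
    have h3 : (T ^ m) (Submodule.Quotient.mk ⟨p, hp⟩) ∈ LinearMap.range (T ^ (m + (l - k).natAbs)) := by
      have h4 := LinearMap.mem_range_self (T ^ m) (Submodule.Quotient.mk ⟨p, hp⟩)
      rw [← hran] at h4
      exact (iInf_le (fun j => LinearMap.range (T ^ j)) _) h4
    obtain ⟨q, hq⟩ := h3
    obtain ⟨⟨q, hq'⟩, rfl⟩ := Submodule.Quotient.mk_surjective _ q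
    rw [quotientMul_pow_mk, quotientMul_pow_mk, Submodule.Quotient.eq] at hq
    have hq2 : act (M ^ m) p - act (M ^ (m + (l - k).natAbs)) q ∈ poly L M := by
      rw [← neg_mem_iff, neg_sub]
      exact hq
    refine ⟨act (M ^ (k - m : ℤ)) (act (M ^ m) p - act (M ^ (m + (l - k).natAbs)) q),
      ⟨_, hq2, rfl⟩, ?_⟩
    have e : act (M ^ k) p - act (M ^ (k - m : ℤ)) (act (M ^ m) p - act (M ^ (m + (l - k).natAbs)) q)
        = act (M ^ (k + (l - k).natAbs)) q := by
      rw [map_sub, ← act_mul, ← act_mul, ← zpow_natCast, ← zpow_natCast, ← zpow_add, ← zpow_add]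
      push_cast
      rw [sub_add_cancel, ← add_assoc, sub_add_cancel, sub_sub_cancel]
    rw [e]
    exact fil_antitone M (by omega) ⟨q, hq', rfl⟩

/-- Elements of `ℤⁿ(M)` with bounded denominators lie in some `Mᵏ ℤⁿ[M]`. -/
theorem exists_fil_of_smul_mem_std (M : GL (Fin n) ℚ) {N : ℕ} (hN : N ≠ 0) :
    ∃ k : ℤ, ∀ x ∈ laurent M, (N : ℤ) • x ∈ stdLattice n → x ∈ fil M k := by
  -- Multiplication by `N` embeds `W` into `ℤⁿ`, so `W` is finitely generated, and a finite set of
  -- generators lies in a single step of the filtration.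
  let W : Submodule ℤ (Fin n → ℚ) :=
    laurent M ⊓ (stdLattice n).comap (LinearMap.lsmul ℤ (Fin n → ℚ) (N : ℤ))
  have : Module.Finite ℤ (stdLattice n) := by
    unfold stdLattice
    infer_instance
  let f : W →ₗ[ℤ] stdLattice n :=
    ((LinearMap.lsmul ℤ (Fin n → ℚ) (N : ℤ)).comp W.subtype).codRestrict _ fun x => x.2.2
  have hf : Function.Injective f := by
    intro x y hxy
    have h1 : (N : ℤ) • (x : Fin n → ℚ) = (N : ℤ) • (y : Fin n → ℚ) := congrArg Subtype.val hxy
    exact Subtype.ext (smul_right_injective _ (by exact_mod_cast hN : (N : ℤ) ≠ 0) h1)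
  have hW : W.FG := by
    have := isNoetherian_of_injective f hf
    exact (Submodule.fg_top W).1 (IsNoetherian.noetherian ⊤)
  obtain ⟨S, hS⟩ := hW
  have hk : ∃ k : ℤ, ∀ x ∈ S, x ∈ fil M k := by
    have hSW : ∀ x ∈ S, x ∈ laurent M := fun x hx => (hS ▸ Submodule.subset_span hx : x ∈ W).1
    clear hS
    induction S using Finset.induction_on with
    | empty => exact ⟨0, by simp⟩
    | insert a S _ ih =>
      obtain ⟨k, hk⟩ := ih fun x hx => hSW x (Finset.mem_insert_of_mem hx)
      obtain ⟨l, hl⟩ := exists_mem_fil (hSW a (Finset.mem_insert_self _ _))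
      refine ⟨min k l, fun x hx => ?_⟩
      rcases Finset.mem_insert.1 hx with rfl | hx
      · exact fil_antitone M (min_le_right _ _) hl
      · exact fil_antitone M (min_le_left _ _) (hk x hx)
  obtain ⟨k, hk⟩ := hk
  refine ⟨k, fun x hx hNx => ?_⟩
  have : W ≤ fil M k := by
    rw [← hS, Submodule.span_le]
    exact hk
  exact this ⟨hx, hNx⟩

theorem exists_smul_std_mem_of_span_eq_top {L : Submodule ℤ (Fin n → ℚ)}
    (hL : Submodule.span ℚ (L : Set (Fin n → ℚ)) = ⊤) :
    ∃ N : ℕ, N ≠ 0 ∧ ∀ x ∈ stdLattice n, (N : ℤ) • x ∈ L := by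
  have h1 : ∀ x : Fin n → ℚ, ∃ N : ℕ, N ≠ 0 ∧ (N : ℤ) • x ∈ L := by
    intro x
    have hx : x ∈ Submodule.span ℚ (L : Set (Fin n → ℚ)) := by rw [hL]; trivial
    induction hx using Submodule.span_induction with
    | mem x hx => exact ⟨1, one_ne_zero, by simpa using hx⟩
    | zero => exact ⟨1, one_ne_zero, by simp⟩
    | add x y _ _ hx hy =>
      obtain ⟨N, hN, hx⟩ := hx
      obtain ⟨N', hN', hy⟩ := hy
      refine ⟨N * N', mul_ne_zero hN hN', ?_⟩
      rw [smul_add]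
      refine add_mem ?_ ?_
      · rw [mul_comm, Nat.cast_mul, mul_smul]
        exact L.smul_mem _ hx
      · rw [Nat.cast_mul, mul_smul]
        exact L.smul_mem _ hy
    | smul a x _ hx =>
      obtain ⟨N, hN, hx⟩ := hx
      refine ⟨N * a.den, mul_ne_zero hN a.den_nz, ?_⟩
      have : ((N * a.den : ℕ) : ℤ) • a • x = a.num • (N : ℤ) • x := by
        rw [← Int.cast_smul_eq_zsmul ℚ, ← Int.cast_smul_eq_zsmul ℚ, ← Int.cast_smul_eq_zsmul ℚ,
          smul_smul, smul_smul]
        congr 1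
        push_cast
        have := Rat.mul_den_eq_num a
        linear_combination (N : ℚ) * this
      rw [this]
      exact L.smul_mem _ hx
  choose N hN hNL using h1
  let e : Fin n → (Fin n → ℚ) := fun i => Pi.single i 1
  refine ⟨∏ i, N (e i), Finset.prod_ne_zero_iff.2 fun i _ => hN _, ?_⟩
  rintro _ ⟨z, rfl⟩
  have hz : intVec n z = ∑ i, z i • e i := by
    ext j
    simp [intVec, e, Finset.sum_apply, Pi.single_apply]
  rw [hz, Finset.smul_sum]
  refine Submodule.sum_mem _ fun i _ => ?_
  rw [smul_comm]
  refine L.smul_mem _ ?_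
  rw [← Finset.prod_erase_mul _ _ (Finset.mem_univ i), Nat.cast_mul, mul_smul]
  exact L.smul_mem _ (hNL _)

/-! ### Topology of the completion `ℤⁿ((M))` and the subgroups `cl L M k`. -/

/-- The inclusion `ℤⁿ(M) → ℚⁿ`. -/
def laurentVal (M : GL (Fin n) ℚ) : LaurentGroup M →+ (Fin n → ℚ) where
  toFun y := y.1
  map_zero' := rfl
  map_add' _ _ := rfl

/-- An element of `ℤⁿ(M) ⊆ ℚⁿ` as an element of the metric group `ℤⁿ(M)`. -/
def ofLaurent {M : GL (Fin n) ℚ} {x : Fin n → ℚ} (hx : x ∈ laurent M) : LaurentGroup M := ⟨x, hx⟩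

theorem laurentVal_ofLaurent {M : GL (Fin n) ℚ} {x : Fin n → ℚ} (hx : x ∈ laurent M) :
    laurentVal M (ofLaurent hx) = x := rfl

theorem laurentVal_injective (M : GL (Fin n) ℚ) : Function.Injective (laurentVal M) :=
  fun _ _ h => Subtype.ext h

theorem laurentVal_mem {M : GL (Fin n) ℚ} (x : LaurentGroup M) : laurentVal M x ∈ laurent M := x.2

theorem laurentVal_laurentMul (M : GL (Fin n) ℚ) (j : ℤ) (x : LaurentGroup M) :
    laurentVal M (laurentMul M j x) = act (M ^ j) (laurentVal M x) := rfl

/-- The inclusion `ℤⁿ(M) → ℤⁿ((M))`. -/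
def toSeries (M : GL (Fin n) ℚ) : LaurentGroup M →+ Series M := Completion.toCompl

theorem monomial_eq (M : GL (Fin n) ℚ) (j : ℤ) (z : Fin n → ℤ) :
    monomial M j z =
      toSeries M (ofLaurent (act_intVec_mem_laurent M j z)) := rfl

/-- `Mᵏ L[M] ∩ ℤⁿ(M)` as a subgroup of `ℤⁿ(M)`. -/
def gsub (L : Submodule ℤ (Fin n → ℚ)) (M : GL (Fin n) ℚ) (k : ℤ) :
    AddSubgroup (LaurentGroup M) :=
  (gfil L M k).toAddSubgroup.comap (laurentVal M)

/-- The closure of `Mᵏ L[M]` in `ℤⁿ((M))`. -/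
def cl (L : Submodule ℤ (Fin n → ℚ)) (M : GL (Fin n) ℚ) (k : ℤ) : AddSubgroup (Series M) :=
  ((gsub L M k).map (toSeries M)).topologicalClosure

theorem norm_laurent (M : GL (Fin n) ℚ) (x : LaurentGroup M) :
    ‖x‖ = adicNorm M (laurentVal M x) := rfl

theorem fil_eq_of_residueCard_eq_one {M : GL (Fin n) ℚ} (h : residueCard M = 1) (k : ℤ) :
    fil M k ≤ fil M (k + 1) := by
  have h1 : poly (stdLattice n) M ≤ (poly (stdLattice n) M).map (act M) := by
    unfold residueCard at h
    exact AddSubgroup.relIndex_eq_one.1 h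
  unfold fil
  rw [zpow_add_one, ← map_act_map_act]
  exact Submodule.map_mono h1

theorem adicNorm_le_of_mem_fil {M : GL (Fin n) ℚ} {k : ℤ} {x : Fin n → ℚ} (hx : x ∈ fil M k) :
    adicNorm M x ≤ (residueCard M : ℝ) ^ (-k) := by
  by_cases hex : ∃ k : ℤ, x ∈ fil M k ∧ x ∉ fil M (k + 1)
  · obtain ⟨j, h1, h2⟩ := hex
    unfold adicNorm
    rw [valuation_eq h1 h2]
    refine zpow_le_zpow_right₀ (one_le_residueCard M) (neg_le_neg ?_)
    by_contra! hlt
    exact h2 (fil_antitone M (by omega) hx)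
  · unfold adicNorm valuation
    rw [dif_neg hex]
    exact zpow_nonneg (Nat.cast_nonneg _) _

theorem mem_fil_of_adicNorm_lt {M : GL (Fin n) ℚ} {k : ℤ} {x : Fin n → ℚ} (hx : x ∈ laurent M)
    (h : adicNorm M x < (residueCard M : ℝ) ^ (-k)) : x ∈ fil M (k + 1) := by
  by_contra hk
  obtain ⟨j, hj, hv⟩ := exists_valuation_le hx hk
  refine h.not_ge ?_
  unfold adicNorm
  rw [hv]
  exact zpow_le_zpow_right₀ (one_le_residueCard M) (neg_le_neg hj)

theorem hasBasis_nhds_zero_laurentGroup (M : GL (Fin n) ℚ) :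
    (𝓝 (0 : LaurentGroup M)).HasBasis (fun _ : ℤ => True)
      fun k => (gsub (stdLattice n) M k : Set (LaurentGroup M)) := by
  refine Metric.nhds_basis_ball.to_hasBasis (fun ε hε => ?_) fun k _ => ?_
  -- If `b = 1`, all steps of the filtration coincide, every valuation is `∞` and the distance
  -- vanishes identically. Powers of `b` are then useless for reaching `ε`, so this case is
  -- separate.
  · by_cases hb : residueCard M = 1
    · refine ⟨0, trivial, fun x hx => ?_⟩
      rw [mem_ball_zero_iff, norm_laurent]
      have hv : valuation M (laurentVal M x) = ⊤ := by
        unfold valuation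
        rw [dif_neg]
        rintro ⟨k, h1, h2⟩
        exact h2 (fil_eq_of_residueCard_eq_one hb k h1)
      unfold adicNorm
      rw [hv]
      exact hε
    · have h1 : (1 : ℝ) < residueCard M := by
        have := residueCard_ne_zero M
        exact_mod_cast (by omega : 1 < residueCard M)
      obtain ⟨m, hm⟩ := exists_pow_lt_of_lt_one hε (inv_lt_one_of_one_lt₀ h1)
      refine ⟨m, trivial, fun x hx => ?_⟩
      rw [mem_ball_zero_iff, norm_laurent]
      refine (adicNorm_le_of_mem_fil hx).trans_lt ?_
      rwa [zpow_neg, zpow_natCast, ← inv_pow]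
  -- The exponent is `k - 1` because a norm strictly below `b ^ (-(k - 1))` places the element one
  -- level deeper, in `Mᵏ ℤⁿ[M]`.
  · refine ⟨(residueCard M : ℝ) ^ (-(k - 1)), zpow_pos ?_ _, fun x hx => ?_⟩
    · exact zero_lt_one.trans_le (one_le_residueCard M)
    · rw [mem_ball_zero_iff, norm_laurent] at hx
      have := mem_fil_of_adicNorm_lt (laurentVal_mem x) hx
      rwa [sub_add_cancel] at this

theorem hasBasis_nhds_zero (M : GL (Fin n) ℚ) :
    (𝓝 (0 : Series M)).HasBasis (fun _ : ℤ => True)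
      fun k => (cl (stdLattice n) M k : Set (Series M)) :=
  (hasBasis_nhds_zero_laurentGroup M).hasBasis_of_isDenseInducing Completion.isDenseInducing_coe

theorem toSeries_mem_cl {L : Submodule ℤ (Fin n → ℚ)} {M : GL (Fin n) ℚ} {k : ℤ}
    {x : LaurentGroup M} (hx : laurentVal M x ∈ gfil L M k) : toSeries M x ∈ cl L M k :=
  subset_closure ⟨x, hx, rfl⟩

theorem isOpen_cl_std (M : GL (Fin n) ℚ) (k : ℤ) :
    IsOpen (cl (stdLattice n) M k : Set (Series M)) :=
  AddSubgroup.isOpen_of_mem_nhds _ ((hasBasis_nhds_zero M).mem_of_mem trivial)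

theorem cl_antitone (L : Submodule ℤ (Fin n → ℚ)) (M : GL (Fin n) ℚ) : Antitone (cl L M) :=
  fun _ _ h => closure_mono (Set.image_mono fun _ hx => gfil_antitone L M h hx)

theorem cl_mono {L L' : Submodule ℤ (Fin n → ℚ)} (h : L ≤ L') (M : GL (Fin n) ℚ) (k : ℤ) :
    cl L M k ≤ cl L' M k :=
  closure_mono (Set.image_mono fun _ hx => gfil_mono h M k hx)

theorem toSeries_mem_cl_std {M : GL (Fin n) ℚ} {k : ℤ} {x : LaurentGroup M} :
    toSeries M x ∈ cl (stdLattice n) M k ↔ laurentVal M x ∈ fil M k := by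
  refine ⟨fun h => ?_, toSeries_mem_cl⟩
  have h1 : IsInducing (toSeries M) := (Completion.isDenseInducing_coe (α := LaurentGroup M)).1
  have h2 : x ∈ closure (gsub (stdLattice n) M k : Set (LaurentGroup M)) := by
    rw [h1.closure_eq_preimage_closure_image]
    exact h
  have h3 : IsOpen (gsub (stdLattice n) M k : Set (LaurentGroup M)) :=
    AddSubgroup.isOpen_of_mem_nhds _ ((hasBasis_nhds_zero_laurentGroup M).mem_of_mem trivial)
  rwa [(AddSubgroup.isClosed_of_isOpen _ h3).closure_eq] at h2

theorem exists_sub_toSeries_mem_cl_std {M : GL (Fin n) ℚ} {S : Set (LaurentGroup M)} {y : Series M}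
    (hy : y ∈ closure (toSeries M '' S)) (k : ℤ) :
    ∃ x ∈ S, y - toSeries M x ∈ cl (stdLattice n) M k := by
  have h1 : {z | y - z ∈ cl (stdLattice n) M k} ∈ 𝓝 y := by
    refine (continuous_const.sub continuous_id).continuousAt.preimage_mem_nhds ?_
    simpa using (hasBasis_nhds_zero M).mem_of_mem trivial
  obtain ⟨_, h2, x, hx, rfl⟩ := mem_closure_iff_nhds.1 hy _ h1
  exact ⟨x, hx, h2⟩

theorem exists_toSeries_approx {M : GL (Fin n) ℚ} (y : Series M) (k : ℤ) :
    ∃ x, y - toSeries M x ∈ cl (stdLattice n) M k := by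
  obtain ⟨x, -, hx⟩ := exists_sub_toSeries_mem_cl_std (S := Set.univ) (y := y)
    (by rw [Set.image_univ]; exact Completion.denseRange_coe y) k
  exact ⟨x, hx⟩

theorem exists_mem_cl_std {M : GL (Fin n) ℚ} (y : Series M) : ∃ k, y ∈ cl (stdLattice n) M k := by
  obtain ⟨x, hx⟩ := exists_toSeries_approx y 0
  obtain ⟨k, hk⟩ := exists_mem_fil (laurentVal_mem x)
  refine ⟨min 0 k, ?_⟩
  rw [← sub_add_cancel y (toSeries M x)]
  exact add_mem (cl_antitone _ M (min_le_left _ _) hx)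
    (cl_antitone _ M (min_le_right _ _) (toSeries_mem_cl hk))

theorem eq_zero_of_forall_mem_cl_std {M : GL (Fin n) ℚ} {y : Series M}
    (h : ∀ k, y ∈ cl (stdLattice n) M k) : y = 0 := by
  by_contra hy
  obtain ⟨k, -, hk⟩ := (hasBasis_nhds_zero M).mem_iff.1 (isOpen_ne.mem_nhds (Ne.symm hy))
  exact hk (h k) rfl

section FullSublattice

variable {L : Submodule ℤ (Fin n → ℚ)} (hL : IsFullSublattice L) (M : GL (Fin n) ℚ)

include hL

/-- With `cl_mono`, this makes the closures of `Mᵏ L[M]` a second neighbourhood basis of `0`. It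
comes from the second half of `exists_shift`, which approximates `Mᵏ ℤⁿ[M]` by `Mᵏ⁻ᵐ L[M]` to any
precision. -/
theorem IsFullSublattice.exists_cl_std_le :
    ∃ m : ℕ, ∀ k, cl (stdLattice n) M k ≤ cl L M (k - m) := by
  obtain ⟨m, -, hm⟩ := hL.exists_shift M
  refine ⟨m, fun k => ?_⟩
  refine AddSubgroup.topologicalClosure_minimal _ ?_ (AddSubgroup.isClosed_topologicalClosure _)
  rintro _ ⟨x, hx, rfl⟩
  refine mem_closure_iff_nhds.2 fun t ht => ?_
  have h1 : (fun z => toSeries M x - z) ⁻¹' t ∈ 𝓝 (0 : Series M) := by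
    refine (continuous_const.sub continuous_id).continuousAt.preimage_mem_nhds ?_
    simpa using ht
  obtain ⟨l, -, hl⟩ := (hasBasis_nhds_zero M).mem_iff.1 h1
  obtain ⟨g, hg, hxg⟩ := hm k l _ hx
  have hgl : g ∈ laurent M := by
    have := (laurent M).sub_mem (laurentVal_mem x) (fil_le_laurent M l hxg)
    rwa [sub_sub_cancel] at this
  have h2 : toSeries M (x - ofLaurent hgl) ∈ cl (stdLattice n) M l := toSeries_mem_cl hxg
  have h3 := hl h2
  rw [Set.mem_preimage, map_sub, sub_sub_cancel] at h3
  exact ⟨_, h3, _, hg, rfl⟩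

theorem IsFullSublattice.isOpen_cl (k : ℤ) : IsOpen (cl L M k : Set (Series M)) := by
  obtain ⟨m, hm⟩ := hL.exists_cl_std_le M
  refine AddSubgroup.isOpen_mono ?_ (isOpen_cl_std M (k + m))
  have := hm (k + m)
  rwa [add_sub_cancel_right] at this

variable {M}

theorem IsFullSublattice.exists_mem_cl (y : Series M) : ∃ k, y ∈ cl L M k := by
  obtain ⟨m, hm⟩ := hL.exists_cl_std_le M
  obtain ⟨k, hk⟩ := exists_mem_cl_std y
  exact ⟨_, hm k hk⟩

theorem IsFullSublattice.exists_approx {y : Series M} {j : ℤ} (hy : y ∈ cl L M j) (k : ℤ) :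
    ∃ x, laurentVal M x ∈ gfil L M j ∧ y - toSeries M x ∈ cl L M k := by
  obtain ⟨m, hm⟩ := hL.exists_cl_std_le M
  obtain ⟨x, hx, h⟩ := exists_sub_toSeries_mem_cl_std hy (k + m)
  have := hm _ h
  rw [add_sub_cancel_right] at this
  exact ⟨x, hx, this⟩

/-- Passing to the closure adds no new elements of `L(M)`. The restriction to `L(M)`, expressed by
`hx`, is what allows the first half of `exists_shift` to turn closeness in the metric of `ℤⁿ` into
membership in `Mᵏ L[M]`. -/
theorem IsFullSublattice.mem_gfil_of_toSeries_mem_cl {x : LaurentGroup M} {j k : ℤ}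
    (hx : laurentVal M x ∈ gfil L M j) (h : toSeries M x ∈ cl L M k) :
    laurentVal M x ∈ gfil L M k := by
  obtain ⟨m, hm, -⟩ := hL.exists_shift M
  obtain ⟨g, hg, h⟩ := exists_sub_toSeries_mem_cl_std h (k + m)
  rw [← map_sub, toSeries_mem_cl_std] at h
  have h1 : laurentVal M (x - g) ∈ gfil L M (min j k) := by
    rw [map_sub]
    exact sub_mem (gfil_antitone L M (min_le_left _ _) hx) (gfil_antitone L M (min_le_right _ _) hg)
  have h2 := hm _ _ _ h1 h
  rw [add_sub_cancel_right] at h2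
  have h3 := add_mem h2 (show laurentVal M g ∈ gfil L M k from hg)
  rwa [← map_add, sub_add_cancel] at h3

end FullSublattice

theorem seriesMul_toSeries (M : GL (Fin n) ℚ) (j : ℤ) (x : LaurentGroup M) :
    seriesMul M j (toSeries M x) = toSeries M (laurentMul M j x) :=
  AddMonoidHom.completion_coe _ (continuous_laurentMul M j) x

theorem continuous_seriesMul (M : GL (Fin n) ℚ) (j : ℤ) : Continuous (seriesMul M j) :=
  AddMonoidHom.continuous_completion _ (continuous_laurentMul M j)

theorem seriesMul_seriesMul (M : GL (Fin n) ℚ) (i j : ℤ) (y : Series M) :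
    seriesMul M i (seriesMul M j y) = seriesMul M (i + j) y := by
  induction y using Completion.induction_on with
  | hp =>
    exact isClosed_eq ((continuous_seriesMul M i).comp (continuous_seriesMul M j))
      (continuous_seriesMul M _)
  | ih x =>
    change seriesMul M i (seriesMul M j (toSeries M x)) = seriesMul M (i + j) (toSeries M x)
    rw [seriesMul_toSeries, seriesMul_toSeries, seriesMul_toSeries]
    congr 1
    apply Subtype.ext
    change act _ (act _ _) = act _ _
    rw [← act_mul, ← zpow_add]

theorem seriesMul_zero (M : GL (Fin n) ℚ) (y : Series M) : seriesMul M 0 y = y := by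
  induction y using Completion.induction_on with
  | hp => exact isClosed_eq (continuous_seriesMul M 0) continuous_id
  | ih x =>
    change seriesMul M 0 (toSeries M x) = toSeries M x
    rw [seriesMul_toSeries]
    congr 1
    apply Subtype.ext
    change act _ _ = _
    rw [zpow_zero, act_one]

theorem seriesMul_monomial (M : GL (Fin n) ℚ) (i j : ℤ) (z : Fin n → ℤ) :
    seriesMul M i (monomial M j z) = monomial M (i + j) z := by
  rw [monomial_eq, monomial_eq, seriesMul_toSeries]
  congr 1
  apply laurentVal_injective
  rw [laurentVal_laurentMul, laurentVal_ofLaurent, laurentVal_ofLaurent, ← act_mul, ← zpow_add]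

theorem seriesMul_mem_cl_of_mem {L : Submodule ℤ (Fin n → ℚ)} {M : GL (Fin n) ℚ} {j k : ℤ}
    {y : Series M} (hy : y ∈ cl L M k) : seriesMul M j y ∈ cl L M (k + j) := by
  refine map_mem_closure (continuous_seriesMul M j) hy ?_
  rintro _ ⟨x, hx, rfl⟩
  rw [seriesMul_toSeries]
  exact ⟨_, (act_mem_gfil j k).2 hx, rfl⟩

theorem seriesMul_mem_cl {L : Submodule ℤ (Fin n → ℚ)} {M : GL (Fin n) ℚ} {j k : ℤ}
    {y : Series M} : seriesMul M j y ∈ cl L M (k + j) ↔ y ∈ cl L M k := by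
  refine ⟨fun h => ?_, seriesMul_mem_cl_of_mem⟩
  have := seriesMul_mem_cl_of_mem (j := -j) h
  rwa [seriesMul_seriesMul, neg_add_cancel, seriesMul_zero, add_neg_cancel_right] at this

theorem exists_finite_cover_cl_std (M : GL (Fin n) ℚ) (k : ℤ) :
    ∃ T : Set (Series M), T.Finite ∧ ∀ y ∈ cl (stdLattice n) M k, ∃ t ∈ T,
      y - t ∈ cl (stdLattice n) M (k + 1) := by
  have hfin : Finite ((poly (stdLattice n) M).toAddSubgroup ⧸
      ((poly (stdLattice n) M).map (act M)).toAddSubgroup.addSubgroupOf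
        (poly (stdLattice n) M).toAddSubgroup) :=
    haveI : (((poly (stdLattice n) M).map (act M)).toAddSubgroup.addSubgroupOf
        (poly (stdLattice n) M).toAddSubgroup).FiniteIndex := ⟨residueCard_ne_zero M⟩
    AddSubgroup.finite_quotient_of_finiteIndex
  let f : (poly (stdLattice n) M).toAddSubgroup → Series M := fun p =>
    toSeries M (ofLaurent (act_mem_laurent k (poly_le_laurent M p.2)))
  refine ⟨Set.range fun q : (poly (stdLattice n) M).toAddSubgroup ⧸
      ((poly (stdLattice n) M).map (act M)).toAddSubgroup.addSubgroupOf
        (poly (stdLattice n) M).toAddSubgroup => f q.out, Set.finite_range _, fun y hy => ?_⟩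
  obtain ⟨x, ⟨p, hp, hpx⟩, hxy⟩ := isFullSublattice_std.exists_approx hy (k + 1)
  let p' : (poly (stdLattice n) M).toAddSubgroup := ⟨p, hp⟩
  refine ⟨_, ⟨QuotientAddGroup.mk p', rfl⟩, ?_⟩
  have h1 := QuotientAddGroup.eq.1 (Quotient.out_eq (QuotientAddGroup.mk p' :
    (poly (stdLattice n) M).toAddSubgroup ⧸ ((poly (stdLattice n) M).map
      (act M)).toAddSubgroup.addSubgroupOf (poly (stdLattice n) M).toAddSubgroup))
  rw [AddSubgroup.mem_addSubgroupOf] at h1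
  set r := (QuotientAddGroup.mk p' : (poly (stdLattice n) M).toAddSubgroup ⧸
    ((poly (stdLattice n) M).map (act M)).toAddSubgroup.addSubgroupOf
        (poly (stdLattice n) M).toAddSubgroup).out
  have h2 : -(r : Fin n → ℚ) + p ∈ gfil (stdLattice n) M 1 := by
    rw [gfil_one]
    exact h1
  have h3 := (act_mem_gfil k 1).2 h2
  have h4 : toSeries M x - f r ∈ cl (stdLattice n) M (k + 1) := by
    change toSeries M x - toSeries M _ ∈ _
    rw [← map_sub]
    refine toSeries_mem_cl ?_
    rw [map_sub, ← hpx, add_comm, laurentVal_ofLaurent, ← map_sub, ← neg_add_eq_sub]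
    exact h3
  simpa using add_mem hxy h4

theorem exists_finite_cover_cl_std_nat (M : GL (Fin n) ℚ) (k : ℤ) (d : ℕ) :
    ∃ T : Set (Series M), T.Finite ∧ ∀ y ∈ cl (stdLattice n) M k, ∃ t ∈ T,
      y - t ∈ cl (stdLattice n) M (k + d) := by
  induction d with
  | zero => exact ⟨{0}, Set.finite_singleton 0, fun y hy => ⟨0, rfl, by simpa using hy⟩⟩
  | succ d ih =>
    obtain ⟨T, hT, h⟩ := ih
    obtain ⟨T', hT', h'⟩ := exists_finite_cover_cl_std M (k + d)
    refine ⟨Set.image2 (· + ·) T T', hT.image2 _ hT', fun y hy => ?_⟩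
    obtain ⟨t, ht, hyt⟩ := h y hy
    obtain ⟨t', ht', hyt'⟩ := h' _ hyt
    refine ⟨_, ⟨t, ht, t', ht', rfl⟩, ?_⟩
    rw [Nat.cast_succ, ← add_assoc, ← sub_sub]
    exact hyt'

/-- Successive quotients of the filtration are finite of order at most `b`, so the closed subgroup
is totally bounded in a complete group. -/
theorem isCompact_cl_std (M : GL (Fin n) ℚ) (k : ℤ) :
    IsCompact (cl (stdLattice n) M k : Set (Series M)) := by
  refine TotallyBounded.isCompact_of_isClosed ?_ isClosed_closure
  rw [totallyBounded_iff_subset_finite_iUnion_nhds_zero]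
  intro U hU
  obtain ⟨l, -, hl⟩ := (hasBasis_nhds_zero M).mem_iff.1 hU
  obtain ⟨T, hT, h⟩ := exists_finite_cover_cl_std_nat M k (l - k).toNat
  refine ⟨T, hT, fun y hy => ?_⟩
  obtain ⟨t, ht, hyt⟩ := h y hy
  refine Set.mem_biUnion ht ⟨y - t, hl (cl_antitone _ M (by omega) hyt), ?_⟩
  simp

/-! ### Digit expansions and fractional parts. -/

theorem monomial_zero (M : GL (Fin n) ℚ) (j : ℤ) : monomial M j 0 = 0 := by
  rw [monomial_eq, ← map_zero (toSeries M)]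
  congr 1
  apply laurentVal_injective
  rw [laurentVal_ofLaurent, map_zero, map_zero, map_zero]

theorem monomial_sub (M : GL (Fin n) ℚ) (j : ℤ) (z z' : Fin n → ℤ) :
    monomial M j (z - z') = monomial M j z - monomial M j z' := by
  rw [monomial_eq, monomial_eq, monomial_eq, ← map_sub]
  congr 1
  apply laurentVal_injective
  exact (congrArg (act (M ^ j)) (map_sub (intVec n) z z')).trans (map_sub _ _ _)

theorem act_mem_gfil_of_mem {L : Submodule ℤ (Fin n → ℚ)} {M : GL (Fin n) ℚ} {x : Fin n → ℚ}
    (hx : x ∈ poly L M) (j : ℤ) : act (M ^ j) x ∈ gfil L M j :=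
  ⟨x, hx, rfl⟩

theorem monomial_mem_cl {L : Submodule ℤ (Fin n → ℚ)} {M : GL (Fin n) ℚ} {z : Fin n → ℤ}
    (hz : intVec n z ∈ L) (j : ℤ) : monomial M j z ∈ cl L M j :=
  toSeries_mem_cl (act_mem_gfil_of_mem (le_poly L M hz) j)

theorem act_mem_poly_inv_of_neg {L : Submodule ℤ (Fin n → ℚ)} {M : GL (Fin n) ℚ} {x : Fin n → ℚ} (hx : x ∈ L)
    {j : ℤ} (hj : j < 0) :
    act (M ^ j) x ∈ poly L M⁻¹ := by
  refine (le_iSup (fun j : ℕ => L.map (act (M⁻¹ ^ j))) (-j).toNat) ⟨x, hx, ?_⟩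
  rw [inv_pow, ← zpow_natCast, ← zpow_neg, Int.toNat_of_nonneg (by omega), neg_neg]

section Expansion

variable {L : Submodule ℤ (Fin n → ℚ)} {M : GL (Fin n) ℚ} {E : Set (Fin n → ℤ)}

/-- Turns convergence into a system of congruences: every partial sum containing the indices below
`k` agrees with the `k`-th truncation modulo `cl L M k`. -/
theorem hasSum_monomial_iff {N : ℤ} {d : ℤ → Fin n → ℤ} {y : Series M} (hL : IsFullSublattice L)
    (hd : ∀ j, intVec n (d j) ∈ L) (h0 : ∀ j < N, d j = 0) :
    HasSum (fun j => monomial M j (d j)) y ↔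
      ∀ k, y - ∑ j ∈ Finset.Ico N k, monomial M j (d j) ∈ cl L M k := by
  have key : ∀ k, ∀ s, Finset.Ico N k ⊆ s →
      ∑ j ∈ s, monomial M j (d j) - ∑ j ∈ Finset.Ico N k, monomial M j (d j) ∈ cl L M k := by
    intro k s hs
    rw [← Finset.sum_sdiff hs, add_sub_cancel_right]
    refine sum_mem fun j hj => ?_
    rw [Finset.mem_sdiff, Finset.mem_Ico, not_and, not_lt] at hj
    by_cases hjN : j < N
    · rw [h0 j hjN, monomial_zero]
      exact zero_mem _
    · exact cl_antitone L M (hj.2 (not_lt.1 hjN)) (monomial_mem_cl (hd j) j)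
  refine ⟨fun h k => ?_, fun h => ?_⟩
  · refine (AddSubgroup.isClosed_of_isOpen _ (hL.isOpen_cl M k)).mem_of_tendsto
      (Tendsto.sub_const h _) ?_
    exact (eventually_ge_atTop (Finset.Ico N k)).mono fun s hs => key k s hs
  · refine tendsto_iff_forall_eventually_mem.2 fun U hU => ?_
    have h1 : (fun z => y - z) ⁻¹' U ∈ 𝓝 (0 : Series M) := by
      refine (continuous_const.sub continuous_id).continuousAt.preimage_mem_nhds ?_
      simpa using hU
    obtain ⟨k, -, hk⟩ := (hasBasis_nhds_zero M).mem_iff.1 h1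
    refine (eventually_ge_atTop (Finset.Ico N k)).mono fun s hs => ?_
    have h2 := hk (cl_mono hL.le_std M k (sub_mem (h k) (key k s hs)))
    rw [sub_sub_sub_cancel_right, Set.mem_preimage, sub_sub_cancel] at h2
    exact h2

variable (hL : IsFullSublattice L) (hE : IsResidueSystem L M E)

include hL hE

theorem exists_digit {y : Series M} {j : ℤ} (hy : y ∈ cl L M j) :
    ∃ e ∈ E, y - monomial M j e ∈ cl L M (j + 1) := by
  obtain ⟨x, ⟨p, hp, hpx⟩, hyx⟩ := hL.exists_approx hy (j + 1)
  obtain ⟨e, ⟨he, hpe⟩, -⟩ := hE.2.2 p hp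
  refine ⟨e, he, ?_⟩
  rw [← gfil_one] at hpe
  have h1 := (act_mem_gfil j 1).2 hpe
  rw [map_sub, hpx, add_comm, ← laurentVal_ofLaurent (act_intVec_mem_laurent M j e),
    ← map_sub] at h1
  have h2 := toSeries_mem_cl h1
  rw [map_sub] at h2
  simpa [monomial_eq] using add_mem hyx h2

/-- The congruence holds in the completion, whereas digits represent `L[M] / M L[M]`. Since both
digits lie in `L`, `mem_gfil_of_toSeries_mem_cl` brings it back to `ℚⁿ`. -/
theorem digit_unique {e e' : Fin n → ℤ} {j : ℤ} (he : e ∈ E) (he' : e' ∈ E)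
    (h : monomial M j e - monomial M j e' ∈ cl L M (j + 1)) : e = e' := by
  have hz : intVec n (e - e') ∈ L := by
    rw [map_sub]
    exact sub_mem (hE.1 e he) (hE.1 e' he')
  rw [← monomial_sub, monomial_eq] at h
  have h1 := hL.mem_gfil_of_toSeries_mem_cl (act_mem_gfil_of_mem (le_poly L M hz) j) h
  rw [laurentVal_ofLaurent, add_comm, act_mem_gfil, gfil_one, map_sub] at h1
  refine (hE.2.2 (intVec n e) (le_poly L M (hE.1 e he))).unique ⟨he, ?_⟩ ⟨he', h1⟩
  rw [sub_self]
  exact zero_mem _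

theorem exists_expansion {y : Series M} {N : ℤ} (hy : y ∈ cl L M N) :
    ∃ d, IsExpansion M E y d ∧ ∀ j < N, d j = 0 := by
  have h1 : ∀ (j : ℤ) (y : Series M), ∃ e, e ∈ E ∧
      (y ∈ cl L M j → y - monomial M j e ∈ cl L M (j + 1)) := by
    intro j y
    by_cases hy : y ∈ cl L M j
    · obtain ⟨e, he, h⟩ := exists_digit hL hE hy
      exact ⟨e, he, fun _ => h⟩
    · exact ⟨0, hE.2.1, fun h => absurd h hy⟩
  choose e he hye using h1
  -- `r i` is the remainder after `i` digits have been removed, so it lies in `cl L M (N + i)`.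
  let r : ℕ → Series M := fun i => Nat.rec y (fun i z => z - monomial M (N + i) (e (N + i) z)) i
  have hr0 : r 0 = y := rfl
  have hr : ∀ i : ℕ, r (i + 1) = r i - monomial M (N + i) (e (N + i) (r i)) := fun i => rfl
  have hrm : ∀ i : ℕ, r i ∈ cl L M (N + i) := by
    intro i
    induction i with
    | zero => simpa [hr0] using hy
    | succ i ih =>
      rw [hr, Nat.cast_succ, ← add_assoc]
      exact hye _ _ ih
  let d : ℤ → Fin n → ℤ := fun j => if j < N then 0 else e j (r (j - N).toNat)
  have hdE : ∀ j, d j ∈ E := by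
    intro j
    by_cases hj : j < N
    · simp only [d, if_pos hj]
      exact hE.2.1
    · simp only [d, if_neg hj]
      exact he _ _
  have hd0 : ∀ j < N, d j = 0 := fun j hj => if_pos hj
  have hdN : ∀ i : ℕ, d (N + i) = e (N + i) (r i) := by
    intro i
    have h1 : ¬ N + (i : ℤ) < N := by omega
    have h2 : (N + (i : ℤ) - N).toNat = i := by omega
    simp only [d, if_neg h1, h2]
  have hsum : ∀ i : ℕ, y - ∑ j ∈ Finset.Ico N (N + i), monomial M j (d j) = r i := by
    intro i
    induction i with
    | zero => simp [hr0]
    | succ i ih =>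
      have h2 : Finset.Ico N (N + (i + 1 : ℕ)) = insert (N + (i : ℤ)) (Finset.Ico N (N + i)) := by
        ext j
        simp only [Finset.mem_Ico, Finset.mem_insert]
        omega
      rw [h2, Finset.sum_insert (by simp), hr, ← ih, hdN, ih]
      rw [← ih]
      abel
  refine ⟨d, ⟨hdE, ⟨N, hd0⟩, ?_⟩, hd0⟩
  rw [hasSum_monomial_iff hL (fun j => hE.1 _ (hdE j)) hd0]
  intro k
  rcases le_total N k with hk | hk
  · have h2 := hsum (k - N).toNat
    have h3 := hrm (k - N).toNat
    rw [show N + ((k - N).toNat : ℤ) = k by omega] at h2 h3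
    rwa [h2]
  · rw [Finset.Ico_eq_empty (by omega), Finset.sum_empty, sub_zero]
    exact cl_antitone L M hk hy

theorem isExpansion_unique {y : Series M} {d d' : ℤ → Fin n → ℤ} (h : IsExpansion M E y d)
    (h' : IsExpansion M E y d') : d = d' := by
  obtain ⟨hE1, ⟨N1, hN1⟩, hs1⟩ := h
  obtain ⟨hE2, ⟨N2, hN2⟩, hs2⟩ := h'
  set N := min N1 N2
  have hN1' : ∀ j < N, d j = 0 := fun j hj => hN1 j (hj.trans_le (min_le_left _ _))
  have hN2' : ∀ j < N, d' j = 0 := fun j hj => hN2 j (hj.trans_le (min_le_right _ _))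
  rw [hasSum_monomial_iff hL (fun j => hE.1 _ (hE1 j)) hN1'] at hs1
  rw [hasSum_monomial_iff hL (fun j => hE.1 _ (hE2 j)) hN2'] at hs2
  have key : ∀ i : ℕ, ∀ j < N + (i : ℤ), d j = d' j := by
    intro i
    induction i with
    | zero =>
      intro j hj
      rw [Nat.cast_zero, add_zero] at hj
      rw [hN1' j hj, hN2' j hj]
    | succ i ih =>
      intro j hj
      by_cases hji : j < N + i
      · exact ih j hji
      · obtain rfl : j = N + i := by push_cast at hj; omega
        refine digit_unique hL hE (j := N + i) (hE1 _) (hE2 _) ?_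
        have h2 : Finset.Ico N (N + i + 1) = insert (N + (i : ℤ)) (Finset.Ico N (N + i)) := by
          ext j
          simp only [Finset.mem_Ico, Finset.mem_insert]
          omega
        have h3 := sub_mem (hs2 (N + i + 1)) (hs1 (N + i + 1))
        rw [h2, Finset.sum_insert (by simp), Finset.sum_insert (by simp),
          Finset.sum_congr rfl fun j hj => congrArg (monomial M j) (ih j (Finset.mem_Ico.1 hj).2).symm]
          at h3
        convert h3 using 1
        abel
  funext j
  exact key (j - N + 1).toNat j (by omega)

theorem existsUnique_isExpansion (y : Series M) : ∃! d, IsExpansion M E y d := by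
  obtain ⟨N, hN⟩ := hL.exists_mem_cl y
  obtain ⟨d, hd, -⟩ := exists_expansion hL hE hN
  exact ⟨d, hd, fun d' hd' => isExpansion_unique hL hE hd' hd⟩

theorem isExpansion_digits (y : Series M) : IsExpansion M E y (digits M E y) := by
  have h := (existsUnique_isExpansion hL hE y).exists
  unfold digits
  rw [dif_pos h]
  exact h.choose_spec

theorem digits_eq {y : Series M} {d : ℤ → Fin n → ℤ} (h : IsExpansion M E y d) :
    digits M E y = d :=
  isExpansion_unique hL hE (isExpansion_digits hL hE y) h

theorem intVec_digits_mem (y : Series M) (j : ℤ) : intVec n (digits M E y j) ∈ L :=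
  hE.1 _ ((isExpansion_digits hL hE y).1 j)

theorem digits_eq_zero {y : Series M} {N : ℤ} (hy : y ∈ cl L M N) {j : ℤ} (hj : j < N) :
    digits M E y j = 0 := by
  obtain ⟨d, hd, h0⟩ := exists_expansion hL hE hy
  rw [digits_eq hL hE hd]
  exact h0 j hj

theorem sub_sum_digits_mem_cl {y : Series M} {N : ℤ} (hy : y ∈ cl L M N) (k : ℤ) :
    y - ∑ j ∈ Finset.Ico N k, monomial M j (digits M E y j) ∈ cl L M k :=
  (hasSum_monomial_iff hL (intVec_digits_mem hL hE y)
    fun _ hj => digits_eq_zero hL hE hy hj).1 (isExpansion_digits hL hE y).2.2 k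

theorem digits_seriesMul (i : ℤ) (y : Series M) (j : ℤ) :
    digits M E (seriesMul M i y) j = digits M E y (j - i) := by
  obtain ⟨h1, ⟨N, h2⟩, h3⟩ := isExpansion_digits hL hE y
  refine congrFun (digits_eq hL hE ⟨fun j => h1 (j - i), ⟨N + i, fun j hj => h2 _ (by omega)⟩, ?_⟩) j
  have h4 := h3.map (seriesMul M i) (continuous_seriesMul M i)
  rw [← (Equiv.subRight i).hasSum_iff] at h4
  convert h4 using 2 with j
  simp [seriesMul_monomial]

theorem fracPart_eq_sum {y : Series M} {N : ℤ} (hy : y ∈ cl L M N) :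
    fracPart M E y = ∑ j ∈ Finset.Ico N 0, act (M ^ j) (intVec n (digits M E y j)) := by
  unfold fracPart
  refine finsum_mem_eq_sum_of_inter_support_eq _ (s := {j : ℤ | j < 0}) ?_
  ext j
  simp only [Set.mem_inter_iff, Set.mem_ofPred_eq, Function.mem_support, Finset.coe_Ico, Set.mem_Ico]
  refine ⟨fun ⟨h1, h2⟩ => ⟨⟨?_, h1⟩, h2⟩, fun ⟨h1, h2⟩ => ⟨h1.2, h2⟩⟩
  by_contra! hlt
  rw [digits_eq_zero hL hE hy hlt, map_zero, map_zero] at h2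
  exact h2 rfl

theorem fracPart_eq_zero {y : Series M} (hy : y ∈ cl L M 0) : fracPart M E y = 0 := by
  rw [fracPart_eq_sum hL hE hy, Finset.Ico_self, Finset.sum_empty]

theorem fracPart_mem_laurent (y : Series M) : fracPart M E y ∈ laurent M := by
  obtain ⟨N, hN⟩ := hL.exists_mem_cl y
  rw [fracPart_eq_sum hL hE hN]
  exact sum_mem fun j _ => act_intVec_mem_laurent M j _

theorem fracPart_mem_poly_inv (y : Series M) : fracPart M E y ∈ poly L M⁻¹ := by
  obtain ⟨N, hN⟩ := hL.exists_mem_cl y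
  rw [fracPart_eq_sum hL hE hN]
  exact sum_mem fun j hj =>
    act_mem_poly_inv_of_neg (intVec_digits_mem hL hE y j) (Finset.mem_Ico.1 hj).2

theorem sub_fracPart_mem_cl (y : Series M) :
    y - toSeries M (ofLaurent (fracPart_mem_laurent hL hE y)) ∈ cl L M 0 := by
  obtain ⟨N, hN⟩ := hL.exists_mem_cl y
  convert sub_sum_digits_mem_cl hL hE hN 0 using 2
  simp only [monomial_eq]
  rw [← map_sum]
  congr 1
  apply laurentVal_injective
  rw [laurentVal_ofLaurent, map_sum, fracPart_eq_sum hL hE hN]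
  rfl

/-- This congruence is all that is used of fractional parts from here on: it yields their additivity
and their values on monomials without tracking carries. -/
theorem sub_fracPart_mem {x : Fin n → ℚ} {y : Series M} (hx : x ∈ poly L M⁻¹)
    (hx' : x ∈ laurent M) (h : y - toSeries M (ofLaurent hx') ∈ cl L M 0) :
    x - fracPart M E y ∈ poly L M⁻¹ ⊓ poly L M := by
  have h1 : x - fracPart M E y ∈ poly L M⁻¹ := sub_mem hx (fracPart_mem_poly_inv hL hE y)
  refine ⟨h1, ?_⟩
  -- An element of `L[M⁻¹]` lies in some `Mʲ L[M]` with `j` possibly negative; this places it in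
  -- `L(M)`, where membership in the closure can be tested algebraically.
  have h2 : ∃ j, x - fracPart M E y ∈ gfil L M j := by
    have h3 : poly L M⁻¹ ≤ ⨆ k, gfil L M k := by
      refine iSup_le fun j => ?_
      rintro _ ⟨z, hz, rfl⟩
      refine (le_iSup (fun k => gfil L M k) (-j : ℤ)) ⟨z, le_poly L M hz, ?_⟩
      rw [zpow_neg, zpow_natCast, inv_pow]
    have hd : Directed (· ≤ ·) (gfil L M) := fun i j =>
      ⟨min i j, gfil_antitone L M (min_le_left _ _), gfil_antitone L M (min_le_right _ _)⟩
    exact (Submodule.mem_iSup_of_directed _ hd).1 (h3 h1)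
  obtain ⟨j, hj⟩ := h2
  have h4 := sub_mem (sub_fracPart_mem_cl hL hE y) h
  rw [sub_sub_sub_cancel_left, ← map_sub] at h4
  have h5 := hL.mem_gfil_of_toSeries_mem_cl (j := j)
    (x := ofLaurent hx' - ofLaurent (fracPart_mem_laurent hL hE y)) hj h4
  rw [gfil_zero] at h5
  exact h5

theorem fracPart_add (y y' : Series M) :
    fracPart M E y + fracPart M E y' - fracPart M E (y + y') ∈ poly L M⁻¹ ⊓ poly L M := by
  refine sub_fracPart_mem hL hE
    (add_mem (fracPart_mem_poly_inv hL hE y) (fracPart_mem_poly_inv hL hE y'))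
    (add_mem (fracPart_mem_laurent hL hE y) (fracPart_mem_laurent hL hE y')) ?_
  have h1 := add_mem (sub_fracPart_mem_cl hL hE y) (sub_fracPart_mem_cl hL hE y')
  rw [← add_sub_add_comm, ← map_add] at h1
  exact h1

theorem fracPart_monomial_of_neg {z : Fin n → ℤ} (hz : intVec n z ∈ L) {j : ℤ} (hj : j < 0) :
    act (M ^ j) (intVec n z) - fracPart M E (monomial M j z) ∈ poly L M⁻¹ ⊓ poly L M := by
  refine sub_fracPart_mem hL hE (act_mem_poly_inv_of_neg hz hj)
    (act_intVec_mem_laurent M j z) ?_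
  rw [← monomial_eq, sub_self]
  exact zero_mem _

theorem fracPart_monomial_of_nonneg {z : Fin n → ℤ} (hz : intVec n z ∈ L) {j : ℤ} (hj : 0 ≤ j) :
    fracPart M E (monomial M j z) = 0 :=
  fracPart_eq_zero hL hE (cl_antitone L M hj (monomial_mem_cl hz j))

end Expansion

/-! ### Characters with finite image, and abstract duality for filtered groups. -/

/-- The image of `d` is a finite subgroup of the circle, hence cyclic, generated by a primitive
`q`-th root of unity `d x0`. The value `ψ x0` is a `q`-th root of unity, so a power of `d x0`, and
`ψ` is determined by this value because `ker d ⊆ ker ψ`. -/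
theorem exists_pow_eq_of_ker_le {H : Type*} [AddCommGroup H] {d ψ : AddChar H Circle}
    (hd : (Set.range d).Finite) (h : ∀ x, d x = 1 → ψ x = 1) : ∃ a : ℕ, ψ = d ^ a := by
  let D : Subgroup Circle := d.toMonoidHom.range
  have hD : ∀ x, d x ∈ D := fun x => ⟨Multiplicative.ofAdd x, rfl⟩
  have hfin : Finite D := by
    refine (hd.subset ?_).to_subtype
    rintro _ ⟨x, rfl⟩
    exact ⟨x.toAdd, rfl⟩
  let i : D →* ℂ := Circle.coeHom.comp D.subtype
  have hi : Function.Injective i := fun x y hxy => Subtype.ext (Circle.coe_injective hxy)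
  have hcyc : IsCyclic D := isCyclic_of_injective_ringHom i hi
  obtain ⟨⟨_, ⟨h0, rfl⟩⟩, hg⟩ := hcyc.exists_generator
  replace hg : ∀ x, ∃ m : ℤ, d (m • h0.toAdd) = d x := by
    intro x
    obtain ⟨m, hm⟩ := Subgroup.mem_zpowers_iff.1 (hg ⟨_, hD x⟩)
    refine ⟨m, ?_⟩
    rw [AddChar.map_zsmul_eq_zpow]
    exact congrArg Subtype.val hm
  set x0 := h0.toAdd
  set q := orderOf (⟨_, hD x0⟩ : D)
  have hq : 0 < q := orderOf_pos _
  have hprim : IsPrimitiveRoot ((d x0 : Circle) : ℂ) q := by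
    have := (IsPrimitiveRoot.orderOf (⟨_, hD x0⟩ : D)).map_of_injective hi
    exact this
  have hpow : (d x0) ^ q = 1 := by
    have := pow_orderOf_eq_one (⟨_, hD x0⟩ : D)
    exact congrArg Subtype.val this
  have hψ : (ψ x0) ^ q = 1 := by
    rw [← AddChar.map_nsmul_eq_pow] at hpow ⊢
    exact h _ hpow
  have : NeZero q := ⟨hq.ne'⟩
  obtain ⟨a, -, ha⟩ := hprim.eq_pow_of_pow_eq_one (ξ := ((ψ x0 : Circle) : ℂ)) (by
    rw [← Circle.coe_pow, hψ, Circle.coe_one])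
  have ha' : ψ x0 = d x0 ^ a := by
    apply Circle.ext
    rw [Circle.coe_pow]
    exact ha.symm
  refine ⟨a, ?_⟩
  ext x
  congr 1
  obtain ⟨m, hm⟩ := hg x
  have h1 : ψ (x - m • x0) = 1 := h _ (by rw [AddChar.map_sub_eq_div, hm, div_self'])
  rw [AddChar.map_sub_eq_div, div_eq_one] at h1
  rw [h1, AddChar.pow_apply, ← hm, AddChar.map_zsmul_eq_zpow, AddChar.map_zsmul_eq_zpow, ha',
    ← zpow_natCast, ← zpow_natCast, ← zpow_mul, ← zpow_mul, mul_comm]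

/-- By induction on `T`: on the common kernel of the remaining characters, `ψ` is a power of `d`.
Dividing by this power leaves a character that is trivial there. -/
theorem mem_closure_of_iInf_ker_le {H : Type*} [AddCommGroup H] (T : Finset (AddChar H Circle))
    (hT : ∀ d ∈ T, (Set.range d).Finite) (ψ : AddChar H Circle)
    (h : ∀ x, (∀ d ∈ T, d x = 1) → ψ x = 1) :
    ψ ∈ Subgroup.closure (T : Set (AddChar H Circle)) := by
  classical
  induction T using Finset.induction_on generalizing ψ with
  | empty =>
    have : ψ = 1 := by
      ext x
      rw [h x (by simp)]
      rfl
    rw [this]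
    exact one_mem _
  | insert d T _ ih =>
    let H0 : AddSubgroup H :=
      { carrier := {x | ∀ t ∈ T, t x = 1}
        zero_mem' := fun t _ => t.map_zero_eq_one
        add_mem' := fun {x y} hx hy t ht => by rw [AddChar.map_add_eq_mul, hx t ht, hy t ht, one_mul]
        neg_mem' := fun {x} hx t ht => by rw [AddChar.map_neg_eq_inv, hx t ht, inv_one] }
    obtain ⟨a, ha⟩ := exists_pow_eq_of_ker_le (d := d.compAddMonoidHom H0.subtype)
      (ψ := ψ.compAddMonoidHom H0.subtype)
      ((hT d (Finset.mem_insert_self _ _)).subset (by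
        rintro _ ⟨x, rfl⟩
        exact ⟨x, rfl⟩))
      (fun x hx => h _ fun t ht => by
        rcases Finset.mem_insert.1 ht with rfl | ht
        · exact hx
        · exact x.2 t ht)
    have h1 : ψ * (d ^ a)⁻¹ ∈ Subgroup.closure (T : Set (AddChar H Circle)) := by
      refine ih (fun t ht => hT t (Finset.mem_insert_of_mem ht)) _ fun x hx => ?_
      have h2 : ψ x = (d ^ a) x := DFunLike.congr_fun ha (⟨x, hx⟩ : H0)
      rw [AddChar.mul_apply, AddChar.inv_apply', h2, mul_inv_cancel]
    have h3 : d ∈ Subgroup.closure ((insert d T : Finset _) : Set (AddChar H Circle)) :=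
      Subgroup.subset_closure (Finset.mem_coe.2 (Finset.mem_insert_self _ _))
    have h4 := mul_mem (Subgroup.closure_mono (by simp) h1) (pow_mem h3 a)
    rwa [inv_mul_cancel_right] at h4

theorem isLocallyConstant_of_eq_one_on_open {H : Type*} [AddCommGroup H] [TopologicalSpace H]
    [IsTopologicalAddGroup H] {V : AddSubgroup H} (hV : IsOpen (V : Set H)) {ψ : AddChar H Circle}
    (h : ∀ x ∈ V, ψ x = 1) : IsLocallyConstant ψ := by
  refine (IsLocallyConstant.iff_exists_open _).2 fun x => ?_
  refine ⟨(fun y => y - x) ⁻¹' V, hV.preimage (continuous_id.sub continuous_const), ?_, ?_⟩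
  · rw [Set.mem_preimage, sub_self]
    exact V.zero_mem
  · intro y hy
    have := h _ hy
    rwa [AddChar.map_sub_eq_div, div_eq_one] at this

/-- The open right half of the circle contains no nontrivial subgroup. -/
theorem eq_one_of_mapsTo_centeredArc {H : Type*} [AddCommGroup H] {V : AddSubgroup H}
    {ψ : AddChar H Circle} (h : ∀ x ∈ V, ψ x ∈ Circle.centeredArc (Real.pi / 2)) :
    ∀ x ∈ V, ψ x = 1 := by
  intro x hx
  refine Circle.eq_one_of_forall_pow_mem_centeredArc_pi_div_two fun m _ => ?_
  rw [← AddChar.map_nsmul_eq_pow]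
  exact h _ (V.nsmul_mem hx m)

/-- A pairing between two groups filtered by compact open subgroups, `K` and `K'`, under which each
filtration is, up to a shift, the annihilator of the other one. -/
structure IsDualPairing {K K' : Type*} [AddCommGroup K] [TopologicalSpace K] [AddCommGroup K']
    [TopologicalSpace K'] (U : ℤ → AddSubgroup K) (U' : ℤ → AddSubgroup K')
    (χ : K' → AddChar K Circle) : Prop where
  antitone : Antitone U
  antitone' : Antitone U'
  hasBasis : (𝓝 (0 : K)).HasBasis (fun _ : ℤ => True) fun k => (U k : Set K)
  hasBasis' : (𝓝 (0 : K')).HasBasis (fun _ : ℤ => True) fun k => (U' k : Set K')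
  isCompact : ∀ k, IsCompact (U k : Set K)
  exists_mem : ∀ x, ∃ k, x ∈ U k
  exists_mem' : ∀ s, ∃ k, s ∈ U' k
  map_add : ∀ s t, χ (s + t) = χ s * χ t
  eq_one : ∃ c : ℤ, ∀ k l, c ≤ k + l → ∀ s ∈ U' l, ∀ x ∈ U k, χ s x = 1
  mem_of_eq_one : ∀ k s, (∀ x ∈ U k, χ s x = 1) → s ∈ U' (-k)
  eq_zero : ∀ x, (∀ s, χ s x = 1) → x = 0

namespace IsDualPairing

section

variable {K K' : Type*} [AddCommGroup K] [TopologicalSpace K] [AddCommGroup K']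
  [UniformSpace K'] {U : ℤ → AddSubgroup K} {U' : ℤ → AddSubgroup K'} {χ : K' → AddChar K Circle}
  (P : IsDualPairing U U' χ)

include P

theorem isOpen [IsTopologicalAddGroup K] (k : ℤ) : IsOpen (U k : Set K) :=
  AddSubgroup.isOpen_of_mem_nhds _ (P.hasBasis.mem_of_mem trivial)

theorem isOpen' [IsUniformAddGroup K'] (k : ℤ) : IsOpen (U' k : Set K') :=
  AddSubgroup.isOpen_of_mem_nhds _ (P.hasBasis'.mem_of_mem trivial)

theorem isLocallyConstant [IsTopologicalAddGroup K] (s : K') : IsLocallyConstant (χ s) := by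
  obtain ⟨c, hc⟩ := P.eq_one
  obtain ⟨l, hl⟩ := P.exists_mem' s
  exact isLocallyConstant_of_eq_one_on_open (P.isOpen (c - l)) fun x hx =>
    hc (c - l) l (by omega) s hl x hx

theorem map_sub (s t : K') : χ (s - t) = χ s * (χ t)⁻¹ := by
  rw [eq_mul_inv_iff_mul_eq, ← P.map_add, sub_add_cancel]

theorem exists_eq_one_of_continuous {ψ : AddChar K Circle} (hψ : Continuous ψ) :
    ∃ k, ∀ x ∈ U k, ψ x = 1 := by
  have h1 : ψ ⁻¹' Circle.centeredArc (Real.pi / 2) ∈ 𝓝 (0 : K) := by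
    refine hψ.continuousAt.preimage_mem_nhds ?_
    rw [AddChar.map_zero_eq_one]
    refine (Circle.isOpen_centeredArc _).mem_nhds ?_
    rw [Circle.mem_centeredArc (by linarith [Real.pi_pos])]
    simp [Real.pi_pos]
  obtain ⟨k, -, hk⟩ := P.hasBasis.mem_iff.1 h1
  exact ⟨k, eq_one_of_mapsTo_centeredArc fun x hx => hk hx⟩

/-- The part of `U k` where `ψ ≠ 1` is compact. Since the `χ s` separate points, the open sets `χ s
≠ 1` cover it, and finitely many suffice. The common kernel of these finitely many characters on `U
k` lies in `ker ψ`, so they generate `ψ` there, and the generated group consists of restrictions of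
the `χ s`. -/
theorem exists_eqOn [IsTopologicalAddGroup K] {ψ : AddChar K Circle} (hψ : Continuous ψ) (k : ℤ) :
    ∃ s, ∀ x ∈ U k, χ s x = ψ x := by
  classical
  obtain ⟨m, hm⟩ := P.exists_eq_one_of_continuous hψ
  have hC : IsCompact ((U k : Set K) ∩ {x | ψ x ≠ 1}) := by
    refine (P.isCompact k).inter_right ?_
    exact isOpen_compl_iff.1 (isLocallyConstant_of_eq_one_on_open (P.isOpen m) hm {1}ᶜᶜ)
  obtain ⟨T, hT⟩ := hC.elim_finite_subcover (fun s : K' => {x | χ s x ≠ 1})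
    (fun s => (P.isLocallyConstant s) {1}ᶜ) (by
      intro x hx
      by_contra hxs
      refine hx.2 ?_
      rw [P.eq_zero x, AddChar.map_zero_eq_one]
      intro s
      by_contra hs
      exact hxs (Set.mem_iUnion.2 ⟨s, hs⟩))
  let R : Multiplicative K' →* AddChar (U k) Circle :=
    { toFun := fun s => (χ s.toAdd).compAddMonoidHom (U k).subtype
      map_one' := by
        have : χ 0 = 1 := by
          have := P.map_add 0 0
          rwa [add_zero, left_eq_mul] at this
        ext x
        rw [toAdd_one, this]
        rfl
      map_mul' := fun s t => by
        ext x
        rw [toAdd_mul, P.map_add]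
        rfl }
  have hmem := mem_closure_of_iInf_ker_le (T.image fun s => R (Multiplicative.ofAdd s)) (by
      intro d hd
      obtain ⟨s, -, rfl⟩ := Finset.mem_image.1 hd
      have : CompactSpace (U k) := isCompact_iff_compactSpace.1 (P.isCompact k)
      exact ((P.isLocallyConstant s).comp_continuous
        (continuous_subtype_val : Continuous (Subtype.val : U k → K))).range_finite)
    (ψ.compAddMonoidHom (U k).subtype) (by
      intro x hx
      by_contra hne
      obtain ⟨s, hs⟩ := Set.mem_iUnion.1 (hT ⟨x.2, hne⟩)
      obtain ⟨hsT, hs⟩ := Set.mem_iUnion.1 hs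
      exact hs (hx _ (Finset.mem_image_of_mem _ hsT)))
  have hle : Subgroup.closure ((T.image fun s => R (Multiplicative.ofAdd s) : Finset _) :
      Set (AddChar (U k) Circle)) ≤ R.range := by
    rw [Subgroup.closure_le]
    intro d hd
    obtain ⟨s, -, rfl⟩ := Finset.mem_image.1 (Finset.mem_coe.1 hd)
    exact ⟨_, rfl⟩
  obtain ⟨s, hs⟩ := hle hmem
  exact ⟨s.toAdd, fun x hx => DFunLike.congr_fun hs (⟨x, hx⟩ : U k)⟩

theorem sub_mem_of_eqOn {s t : K'} {k : ℤ} (h : ∀ x ∈ U k, χ s x = χ t x) :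
    s - t ∈ U' (-k) := by
  refine P.mem_of_eq_one k _ fun x hx => ?_
  rw [P.map_sub, AddChar.mul_apply, AddChar.inv_apply', h x hx, mul_inv_cancel]

/-- The parameters matching `ψ` on the growing subgroups `U (-i)` differ by elements of the
shrinking `U' i`. They are therefore Cauchy, and the limit matches `ψ` everywhere. -/
theorem exists_eq [IsTopologicalAddGroup K] [IsUniformAddGroup K'] [CompleteSpace K'] {ψ : AddChar K Circle} (hψ : Continuous ψ) :
    ∃ s, χ s = ψ := by
  choose s hs using P.exists_eqOn hψ
  let t : ℕ → K' := fun i => s (-i)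
  have ht : ∀ i j : ℕ, i ≤ j → t j - t i ∈ U' i := by
    intro i j hij
    have := P.sub_mem_of_eqOn (s := t j) (t := t i) (k := -i) fun x hx => by
      rw [hs _ x (P.antitone (by omega) hx), hs _ x hx]
    rwa [neg_neg] at this
  have hcauchy : CauchySeq t := by
    refine cauchySeq_iff_tendsto.2 ?_
    rw [uniformity_eq_comap_nhds_zero, tendsto_comap_iff]
    refine P.hasBasis'.tendsto_right_iff.2 fun l _ => ?_
    refine (eventually_ge_atTop (l.toNat, l.toNat)).mono fun p hp => ?_
    have h1 := P.antitone' (by omega : l ≤ (l.toNat : ℤ)) (ht l.toNat p.1 hp.1)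
    have h2 := P.antitone' (by omega : l ≤ (l.toNat : ℤ)) (ht l.toNat p.2 hp.2)
    have h3 := sub_mem h2 h1
    rwa [sub_sub_sub_cancel_right] at h3
  obtain ⟨u, hu⟩ := cauchySeq_tendsto_of_complete hcauchy
  have hut : ∀ i : ℕ, u - t i ∈ U' i := by
    intro i
    refine (AddSubgroup.isClosed_of_isOpen _ (P.isOpen' i)).mem_of_tendsto (hu.sub_const (t i)) ?_
    exact (eventually_ge_atTop i).mono fun j hj => ht i j hj
  obtain ⟨c, hc⟩ := P.eq_one
  refine ⟨u, ?_⟩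
  ext x
  congr 1
  obtain ⟨k, hk⟩ := P.exists_mem x
  -- Large enough both for `x ∈ U (-i)` and for `U' i` to annihilate `U k`.
  let i : ℕ := max (-k).toNat (c - k).toNat
  have h1 : χ (u - t i) x = 1 := hc k i (by omega) _ (hut i) x hk
  rw [P.map_sub, AddChar.mul_apply, AddChar.inv_apply', mul_inv_eq_one] at h1
  rw [h1]
  exact hs _ x (P.antitone (by omega) hk)

/-- The homomorphism `s ↦ χ s` to the Pontryagin dual. -/
def toDual [IsTopologicalAddGroup K] :
    Multiplicative K' →* PontryaginDual (Multiplicative K) where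
  toFun s :=
    ({ toMonoidHom := (χ s.toAdd).toMonoidHom
       continuous_toFun := (P.isLocallyConstant s.toAdd).continuous } :
      Multiplicative K →ₜ* Circle)
  map_one' := by
    have : χ 0 = 1 := by
      have := P.map_add 0 0
      rwa [add_zero, left_eq_mul] at this
    ext x
    change ((χ 0 x.toAdd : Circle) : ℂ) = _
    rw [this]
    rfl
  map_mul' s t := by
    ext x
    change ((χ (s.toAdd + t.toAdd) x.toAdd : Circle) : ℂ) = _
    rw [P.map_add]
    rfl

theorem toDual_apply [IsTopologicalAddGroup K] (s : Multiplicative K') (x : Multiplicative K) :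
    P.toDual s x = χ s.toAdd x.toAdd := rfl

theorem toDual_bijective [IsTopologicalAddGroup K] [IsUniformAddGroup K'] [CompleteSpace K'] [T2Space K'] : Function.Bijective P.toDual := by
  constructor
  · intro s t hst
    have h1 : ∀ k, s.toAdd - t.toAdd ∈ U' k := by
      intro k
      rw [← neg_neg k]
      exact P.sub_mem_of_eqOn fun x _ => DFunLike.congr_fun hst (Multiplicative.ofAdd x)
    have h2 : s.toAdd - t.toAdd = 0 := by
      by_contra hne
      obtain ⟨k, -, hk⟩ := P.hasBasis'.mem_iff.1 (isOpen_ne.mem_nhds (Ne.symm hne))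
      exact hk (h1 k) rfl
    exact Multiplicative.toAdd.injective (sub_eq_zero.1 h2)
  · intro ψ
    let ψ' : AddChar K Circle := AddChar.toMonoidHomEquiv.symm (ψ : Multiplicative K →* Circle)
    obtain ⟨s, hs⟩ := P.exists_eq (ψ := ψ') (map_continuous ψ)
    refine ⟨Multiplicative.ofAdd s, ?_⟩
    ext x
    rw [toDual_apply, toAdd_ofAdd, hs]
    rfl

theorem continuous_toDual [IsTopologicalAddGroup K] [IsUniformAddGroup K'] : Continuous P.toDual := by
  obtain ⟨c, hc⟩ := P.eq_one
  refine (ContinuousMonoidHom.isInducing_toContinuousMap _ _).continuous_iff.2 ?_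
  refine ContinuousMap.continuous_compactOpen.2 fun C hC W hW => ?_
  -- A compact set lies in one `U k`; parameters congruent modulo `U' (c - k)` give characters that
  -- agree on it.
  obtain ⟨k, hk⟩ : ∃ k, ∀ x ∈ C, Multiplicative.toAdd x ∈ U k := by
    obtain ⟨k, hk⟩ := hC.elim_directed_cover (fun k => Multiplicative.toAdd ⁻¹' (U k : Set K))
      (fun k => (P.isOpen k).preimage continuous_toAdd)
      (fun x _ => Set.mem_iUnion.2 (P.exists_mem x.toAdd))
      (fun i j => ⟨min i j, fun x hx => P.antitone (min_le_left _ _) hx,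
        fun x hx => P.antitone (min_le_right _ _) hx⟩)
    exact ⟨k, hk⟩
  refine isOpen_iff_mem_nhds.2 fun s hs => ?_
  have h1 : (fun t : Multiplicative K' => t.toAdd - s.toAdd) ⁻¹' (U' (c - k)) ∈ 𝓝 s := by
    refine (continuous_toAdd.sub continuous_const).continuousAt.preimage_mem_nhds ?_
    rw [Pi.sub_apply, sub_self]
    exact P.hasBasis'.mem_of_mem trivial
  refine mem_of_superset h1 fun t ht x hx => ?_
  have h2 := hc k (c - k) (by omega) _ ht _ (hk x hx)
  rw [P.map_sub, AddChar.mul_apply, AddChar.inv_apply', mul_inv_eq_one] at h2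
  change P.toDual t x ∈ W
  rw [toDual_apply, h2]
  exact hs hx

/-- The isomorphism of topological groups `s ↦ χ s` onto the Pontryagin dual. -/
def equivDual [IsTopologicalAddGroup K] [IsUniformAddGroup K'] [CompleteSpace K'] [T2Space K'] :
    Multiplicative K' ≃ₜ* PontryaginDual (Multiplicative K) where
  toMulEquiv := MulEquiv.ofBijective P.toDual P.toDual_bijective
  continuous_toFun := P.continuous_toDual
  continuous_invFun := by
    refine continuous_of_continuousAt_one
      (MulEquiv.ofBijective P.toDual P.toDual_bijective).symm ?_
    rw [ContinuousAt, _root_.map_one]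
    intro W hW
    obtain ⟨l, -, hl⟩ := P.hasBasis'.mem_iff.1 (show Multiplicative.ofAdd ⁻¹' W ∈ 𝓝 (0 : K') from hW)
    -- A character in this neighbourhood maps the subgroup `U (-l)` into the half circle, so it is
    -- trivial there, and its parameter lies in `U' l`.
    have hV : {ψ : PontryaginDual (Multiplicative K) | Set.MapsTo ψ
        (Multiplicative.toAdd ⁻¹' (U (-l) : Set K)) (Circle.centeredArc (Real.pi / 2))} ∈
        𝓝 (1 : PontryaginDual (Multiplicative K)) := by
      refine IsOpen.mem_nhds ?_ ?_
      · exact isOpen_induced (ContinuousMap.isOpen_setOfPred_mapsTo (P.isCompact (-l))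
          (Circle.isOpen_centeredArc (Real.pi / 2)))
      · intro x _
        rw [PontryaginDual.one_apply, Circle.mem_centeredArc (by linarith [Real.pi_pos])]
        simp [Real.pi_pos]
    refine mem_map.2 (mem_of_superset hV fun ψ hψ => ?_)
    obtain ⟨s, rfl⟩ := P.toDual_bijective.2 ψ
    rw [Set.mem_preimage]
    have hs : (MulEquiv.ofBijective P.toDual P.toDual_bijective).symm (P.toDual s) = s :=
      MulEquiv.symm_apply_apply (MulEquiv.ofBijective P.toDual P.toDual_bijective) s
    rw [hs]
    have h1 := P.mem_of_eq_one (-l) s.toAdd (eq_one_of_mapsTo_centeredArc fun x hx => hψ hx)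
    rw [neg_neg] at h1
    exact hl h1

end

end IsDualPairing

/-! ### The pairing of `ℤⁿ((B))` with `ℤⁿ((B*))`. -/

/-- The character `q ↦ exp(2πiq)` of `ℚ`. -/
def ratExp : AddChar ℚ Circle where
  toFun q := Circle.exp (2 * Real.pi * (q : ℝ))
  map_zero_eq_one' := by simp
  map_add_eq_mul' p q := by rw [← Circle.exp_add]; push_cast; ring_nf

theorem ratExp_eq_one_iff {q : ℚ} : ratExp q = 1 ↔ ∃ m : ℤ, q = m := by
  change Circle.exp (2 * Real.pi * (q : ℝ)) = 1 ↔ _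
  rw [Circle.exp_eq_one]
  refine exists_congr fun m => ?_
  rw [mul_comm, mul_left_inj' (by positivity)]
  exact_mod_cast Iff.rfl

theorem ratExp_eq_of_sub {p q : ℚ} (h : ∃ m : ℤ, p - q = m) : ratExp p = ratExp q := by
  rw [← ratExp_eq_one_iff, AddChar.map_sub_eq_div, div_eq_one] at h
  exact h

theorem ratExp_sum {ι : Type*} (s : Finset ι) (f : ι → ℚ) :
    ratExp (∑ i ∈ s, f i) = ∏ i ∈ s, ratExp (f i) :=
  map_prod ratExp.toMonoidHom (fun i => Multiplicative.ofAdd (f i)) s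

theorem dotProduct_act_transpose (M : GL (Fin n) ℚ) (i : ℤ) (u v : Fin n → ℚ) :
    act (M ^ i) u ⬝ᵥ v = u ⬝ᵥ act (transposeGL M ^ i) v := by
  have h : ((transposeGL M ^ i : GL (Fin n) ℚ) : Matrix (Fin n) (Fin n) ℚ) =
      ((M ^ i : GL (Fin n) ℚ) : Matrix (Fin n) (Fin n) ℚ)ᵀ := by
    rw [Matrix.coe_units_zpow, Matrix.coe_units_zpow, Matrix.transpose_zpow]
    rfl
  simp only [act, LinearMap.coe_restrictScalars, Matrix.mulVecLin_apply, h]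
  rw [Matrix.mulVec_transpose, dotProduct_comm, Matrix.dotProduct_mulVec, dotProduct_comm]

theorem transposeGL_inv_inv (A : GL (Fin n) ℚ) : (transposeGL A⁻¹)⁻¹ = transposeGL A := by
  apply Units.ext
  change (((A⁻¹)⁻¹ : GL (Fin n) ℚ) : Matrix (Fin n) (Fin n) ℚ)ᵀ = _
  rw [inv_inv]
  rfl

/-- The monomials generate the dense subgroup `ℤⁿ(M)`, and triviality on a common open subgroup
replaces continuity. This is how identities between characters are reduced to computations in `ℚⁿ`.
-/
theorem addChar_ext_of_monomial {M : GL (Fin n) ℚ} {f g : AddChar (Series M) Circle} {k : ℤ}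
    (hf : ∀ y ∈ cl (stdLattice n) M k, f y = 1) (hg : ∀ y ∈ cl (stdLattice n) M k, g y = 1)
    (h : ∀ j z, f (monomial M j z) = g (monomial M j z)) : f = g := by
  let W : AddSubgroup (Fin n → ℚ) :=
    { carrier := {x | ∃ hx : x ∈ laurent M,
        f (toSeries M (ofLaurent hx)) = g (toSeries M (ofLaurent hx))}
      zero_mem' := ⟨zero_mem _, by
        have : toSeries M (ofLaurent (zero_mem (laurent M))) = 0 := map_zero (toSeries M)
        rw [this, AddChar.map_zero_eq_one, AddChar.map_zero_eq_one]⟩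
      add_mem' := by
        rintro x y ⟨hx, hx'⟩ ⟨hy, hy'⟩
        refine ⟨add_mem hx hy, ?_⟩
        have : toSeries M (ofLaurent (add_mem hx hy)) =
          toSeries M (ofLaurent hx) + toSeries M (ofLaurent hy) := 
          map_add (toSeries M) (ofLaurent hx) (ofLaurent hy)
        rw [this, AddChar.map_add_eq_mul, AddChar.map_add_eq_mul, hx', hy']
      neg_mem' := by
        rintro x ⟨hx, hx'⟩
        refine ⟨neg_mem hx, ?_⟩
        have : toSeries M (ofLaurent (neg_mem hx)) = -toSeries M (ofLaurent hx) :=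
          map_neg (toSeries M) (ofLaurent hx)
        rw [this, AddChar.map_neg_eq_inv, AddChar.map_neg_eq_inv, hx'] }
  have hW : laurent M ≤ AddSubgroup.toIntSubmodule W := by
    refine iSup_le fun j => ?_
    rintro _ ⟨_, ⟨z, rfl⟩, rfl⟩
    exact ⟨act_intVec_mem_laurent M j z, h j z⟩
  ext y
  congr 1
  obtain ⟨x, hx⟩ := exists_toSeries_approx y k
  obtain ⟨_, hx'⟩ := hW (laurentVal_mem x)
  rw [← sub_add_cancel y (toSeries M x), AddChar.map_add_eq_mul, AddChar.map_add_eq_mul, hf _ hx,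
    hg _ hx]
  congr 1

/-- The data of the pairing of `ℤⁿ((B))` with `ℤⁿ((B*))`: digit sets `E` for `B` and `F` for `B*`
over lattices `ℤⁿ` and `Γ` such that `ℤⁿ[B⁻¹] ∩ ℤⁿ[B]` and `Γ[B*⁻¹] ∩ Γ[B*]` pair integrally. -/
structure IsPairingData (B : GL (Fin n) ℚ) (Γ : Submodule ℤ (Fin n → ℚ))
    (E F : Set (Fin n → ℤ)) : Prop where
  full : IsFullSublattice Γ
  left : IsResidueSystem (stdLattice n) B E
  right : IsResidueSystem Γ (transposeGL B) F
  integral : ∀ u ∈ poly (stdLattice n) B⁻¹ ⊓ poly (stdLattice n) B,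
    ∀ v ∈ poly Γ (transposeGL B)⁻¹ ⊓ poly Γ (transposeGL B), ∃ m : ℤ, u ⬝ᵥ v = m

theorem intVec_mem_std (z : Fin n → ℤ) : intVec n z ∈ stdLattice n := ⟨z, rfl⟩

theorem le_poly_inv_inf_poly (L : Submodule ℤ (Fin n → ℚ)) (M : GL (Fin n) ℚ) :
    L ≤ poly L M⁻¹ ⊓ poly L M :=
  le_inf (le_poly L _) (le_poly L _)

theorem monomial_mem_cl_std (M : GL (Fin n) ℚ) (j : ℤ) (z : Fin n → ℤ) :
    monomial M j z ∈ cl (stdLattice n) M j :=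
  monomial_mem_cl (intVec_mem_std z) j

theorem mem_stdLattice_of_dotProduct {v : Fin n → ℚ}
    (h : ∀ z : Fin n → ℤ, ∃ m : ℤ, intVec n z ⬝ᵥ v = m) : v ∈ stdLattice n := by
  choose m hm using fun i => h (Pi.single i 1)
  refine ⟨m, ?_⟩
  ext i
  change ((m i : ℤ) : ℚ) = v i
  rw [← hm i, dotProduct, Finset.sum_eq_single i]
  · simp [intVec]
  · intro j _ hj
    simp [intVec, hj]
  · simp

namespace IsPairingData

variable {B : GL (Fin n) ℚ} {Γ : Submodule ℤ (Fin n → ℚ)} {E F : Set (Fin n → ℤ)}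
  (P : IsPairingData B Γ E F)

include P

theorem ratExp_dotProduct_congr_left {u u' v : Fin n → ℚ}
    (hu : u - u' ∈ poly (stdLattice n) B⁻¹ ⊓ poly (stdLattice n) B) (hv : v ∈ Γ) :
    ratExp (u ⬝ᵥ v) = ratExp (u' ⬝ᵥ v) := by
  refine ratExp_eq_of_sub ?_
  rw [← sub_dotProduct]
  exact P.integral _ hu _ (le_poly_inv_inf_poly _ _ hv)

theorem ratExp_dotProduct_congr_right {u v v' : Fin n → ℚ} (hu : u ∈ stdLattice n)
    (hv : v - v' ∈ poly Γ (transposeGL B)⁻¹ ⊓ poly Γ (transposeGL B)) :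
    ratExp (u ⬝ᵥ v) = ratExp (u ⬝ᵥ v') := by
  refine ratExp_eq_of_sub ?_
  rw [← dotProduct_sub]
  exact P.integral _ (le_poly_inv_inf_poly _ _ hu) _ hv

theorem fracPart_seriesMul_eq_zero {y : Series B} {j k : ℤ} (hy : y ∈ cl (stdLattice n) B k)
    (hj : -k ≤ j) : fracPart B E (seriesMul B j y) = 0 :=
  fracPart_eq_zero isFullSublattice_std P.left
    (cl_antitone _ B (by omega) (seriesMul_mem_cl_of_mem (j := j) hy))

/-- The digits of `s` vanish below `l`, and `Bʲ y` has no fractional part once `j ≥ -k`. -/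
theorem support_pairing_subset {s : Series (transposeGL B)} {y : Series B} {k l : ℤ}
    (hs : s ∈ cl Γ (transposeGL B) l) (hy : y ∈ cl (stdLattice n) B k) :
    {j : ℤ | fracPart B E (seriesMul B j y) ≠ 0 ∧ digits (transposeGL B) F s j ≠ 0} ⊆
      Finset.Ico l (-k) := by
  intro j hj
  rw [Finset.coe_Ico, Set.mem_Ico]
  constructor
  · by_contra! hlt
    exact hj.2 (digits_eq_zero P.full P.right hs hlt)
  · by_contra! hle
    exact hj.1 (P.fracPart_seriesMul_eq_zero hy hle)

theorem pairing_eq_sum {s : Series (transposeGL B)} {y : Series B} {k l : ℤ}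
    (hs : s ∈ cl Γ (transposeGL B) l) (hy : y ∈ cl (stdLattice n) B k) :
    pairing B E F s y = ∑ j ∈ Finset.Ico l (-k),
      fracPart B E (seriesMul B j y) ⬝ᵥ intVec n (digits (transposeGL B) F s j) := by
  refine finsum_eq_sum_of_support_subset _ fun j hj => P.support_pairing_subset hs hy ?_
  constructor
  · intro h
    rw [Function.mem_support, h, zero_dotProduct] at hj
    exact hj rfl
  · intro h
    rw [Function.mem_support, h, map_zero, dotProduct_zero] at hj
    exact hj rfl

theorem adicChar_eq_prod {s : Series (transposeGL B)} {y : Series B} {k l : ℤ}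
    (hs : s ∈ cl Γ (transposeGL B) l) (hy : y ∈ cl (stdLattice n) B k) :
    adicChar B E F s y = ∏ j ∈ Finset.Ico l (-k),
      ratExp (fracPart B E (seriesMul B j y) ⬝ᵥ intVec n (digits (transposeGL B) F s j)) := by
  change ratExp (pairing B E F s y) = _
  rw [P.pairing_eq_sum hs hy, ratExp_sum]

theorem adicChar_eq_one {s : Series (transposeGL B)} {y : Series B} {k l : ℤ}
    (hs : s ∈ cl Γ (transposeGL B) l) (hy : y ∈ cl (stdLattice n) B k) (hkl : 0 ≤ k + l) :
    adicChar B E F s y = 1 := by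
  rw [P.adicChar_eq_prod hs hy, Finset.Ico_eq_empty (by omega), Finset.prod_empty]

theorem ratExp_fracPart_add (y y' : Series B) {v : Fin n → ℚ} (hv : v ∈ Γ) :
    ratExp (fracPart B E (y + y') ⬝ᵥ v) =
      ratExp (fracPart B E y ⬝ᵥ v) * ratExp (fracPart B E y' ⬝ᵥ v) := by
  rw [← AddChar.map_add_eq_mul, ← add_dotProduct]
  exact (P.ratExp_dotProduct_congr_left (fracPart_add isFullSublattice_std P.left y y') hv).symm

theorem adicChar_add_right (s : Series (transposeGL B)) (y y' : Series B) :
    adicChar B E F s (y + y') = adicChar B E F s y * adicChar B E F s y' := by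
  obtain ⟨l, hs⟩ := P.full.exists_mem_cl s
  obtain ⟨k₁, hy₁⟩ := exists_mem_cl_std y
  obtain ⟨k₂, hy₂⟩ := exists_mem_cl_std y'
  have hy := cl_antitone _ B (min_le_left k₁ k₂) hy₁
  have hy' := cl_antitone _ B (min_le_right k₁ k₂) hy₂
  rw [P.adicChar_eq_prod hs hy, P.adicChar_eq_prod hs hy', P.adicChar_eq_prod hs (add_mem hy hy'),
    ← Finset.prod_mul_distrib]
  refine Finset.prod_congr rfl fun j _ => ?_
  rw [map_add]
  exact P.ratExp_fracPart_add _ _ (intVec_digits_mem P.full P.right s j)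

/-- `χ_s` as an additive character. -/
def char (s : Series (transposeGL B)) : AddChar (Series B) Circle where
  toFun := adicChar B E F s
  map_zero_eq_one' := by
    have := P.adicChar_add_right s 0 0
    rwa [add_zero, left_eq_mul] at this
  map_add_eq_mul' := P.adicChar_add_right s

theorem char_apply (s : Series (transposeGL B)) (y : Series B) :
    P.char s y = adicChar B E F s y := rfl

theorem ratExp_fracPart_monomial {k : ℤ} (hk : k < 0) (z : Fin n → ℤ) {v : Fin n → ℚ}
    (hv : v ∈ Γ) :
    ratExp (fracPart B E (monomial B k z) ⬝ᵥ v) =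
      ratExp (intVec n z ⬝ᵥ act (transposeGL B ^ k) v) := by
  rw [← dotProduct_act_transpose]
  exact (P.ratExp_dotProduct_congr_left (fracPart_monomial_of_neg isFullSublattice_std P.left
    (intVec_mem_std z) hk) hv).symm

/-- For `j + k < 0` the `j`-th term is `⟨Bʲ⁺ᵏ z, s_j⟩` modulo `ℤ`. Transposing gives `⟨z, (B*)ʲ⁺ᵏ
s_j⟩`, and `s_j` is the digit of `(B*)ᵏ s` at `j + k`; hence the reindexing by `k`. -/
theorem char_monomial_right (s : Series (transposeGL B)) (k : ℤ) (z : Fin n → ℤ) :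
    P.char s (monomial B k z) =
      ratExp (intVec n z ⬝ᵥ fracPart (transposeGL B) F (seriesMul (transposeGL B) k s)) := by
  obtain ⟨l, hs⟩ := P.full.exists_mem_cl s
  rw [char_apply, P.adicChar_eq_prod hs (monomial_mem_cl_std B k z),
    fracPart_eq_sum P.full P.right (seriesMul_mem_cl_of_mem hs), dotProduct_sum,
    ratExp_sum]
  refine Finset.prod_nbij' (· + k) (· - k) ?_ ?_ ?_ ?_ ?_
  · intro j hj
    rw [Finset.mem_Ico] at hj ⊢
    omega
  · intro j hj
    rw [Finset.mem_Ico] at hj ⊢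
    omega
  · intro j _
    exact add_sub_cancel_right j k
  · intro j _
    exact sub_add_cancel j k
  · intro j hj
    rw [Finset.mem_Ico] at hj
    rw [seriesMul_monomial, digits_seriesMul P.full P.right, add_sub_cancel_right]
    exact P.ratExp_fracPart_monomial (by omega) z (intVec_digits_mem P.full P.right s j)

/-- Digits of `s + s'` involve carries, so this is not visible termwise. On monomials it becomes the
additivity of fractional parts in `ℤⁿ((B*))` modulo `Γ[B*⁻¹] ∩ Γ[B*]`. -/
theorem char_add (s s' : Series (transposeGL B)) : P.char (s + s') = P.char s * P.char s' := by
  obtain ⟨l₁, hs₁⟩ := P.full.exists_mem_cl s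
  obtain ⟨l₂, hs₂⟩ := P.full.exists_mem_cl s'
  have hs := cl_antitone _ _ (min_le_left l₁ l₂) hs₁
  have hs' := cl_antitone _ _ (min_le_right l₁ l₂) hs₂
  refine addChar_ext_of_monomial (k := -min l₁ l₂) (fun y hy => ?_) (fun y hy => ?_) fun j z => ?_
  · exact P.adicChar_eq_one (add_mem hs hs') hy (by omega)
  · rw [AddChar.mul_apply, char_apply, char_apply, P.adicChar_eq_one hs hy (by omega),
      P.adicChar_eq_one hs' hy (by omega), one_mul]
  · rw [AddChar.mul_apply, P.char_monomial_right, P.char_monomial_right, P.char_monomial_right,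
      ← AddChar.map_add_eq_mul, ← dotProduct_add, map_add]
    exact (P.ratExp_dotProduct_congr_right (intVec_mem_std z)
      (fracPart_add P.full P.right _ _)).symm

/-- Here `γ` is any element of `Γ`, not necessarily a digit, so the definition of the pairing does
not give the value directly. Both sides are characters in `y` and are compared on monomials. -/
theorem char_monomial_left (j : ℤ) {γ : Fin n → ℤ} (hγ : intVec n γ ∈ Γ) (y : Series B) :
    P.char (monomial (transposeGL B) j γ) y =
      ratExp (fracPart B E (seriesMul B j y) ⬝ᵥ intVec n γ) := by
  let g : AddChar (Series B) Circle :=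
    { toFun := fun y => ratExp (fracPart B E (seriesMul B j y) ⬝ᵥ intVec n γ)
      map_zero_eq_one' := by
        rw [map_zero, fracPart_eq_zero isFullSublattice_std P.left (zero_mem _), zero_dotProduct,
          AddChar.map_zero_eq_one]
      map_add_eq_mul' := fun y y' => by
        rw [map_add]
        exact P.ratExp_fracPart_add _ _ hγ }
  refine DFunLike.congr_fun (addChar_ext_of_monomial (k := -j) (f := P.char _) (g := g)
    (fun y hy => ?_) (fun y hy => ?_) fun k z => ?_) y
  · exact P.adicChar_eq_one (monomial_mem_cl hγ j) hy (by omega)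
  · change ratExp (fracPart B E (seriesMul B j y) ⬝ᵥ intVec n γ) = 1
    rw [P.fracPart_seriesMul_eq_zero hy (by omega), zero_dotProduct, AddChar.map_zero_eq_one]
  · change _ = ratExp (fracPart B E (seriesMul B j (monomial B k z)) ⬝ᵥ intVec n γ)
    rw [P.char_monomial_right, seriesMul_monomial, seriesMul_monomial]
    by_cases hjk : j + k < 0
    · rw [P.ratExp_fracPart_monomial hjk z hγ, add_comm k j]
      exact (P.ratExp_dotProduct_congr_right (intVec_mem_std z)
        (fracPart_monomial_of_neg P.full P.right hγ hjk)).symm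
    · rw [fracPart_monomial_of_nonneg P.full P.right hγ (by omega),
        fracPart_monomial_of_nonneg isFullSublattice_std P.left (intVec_mem_std z) (by omega),
        zero_dotProduct, dotProduct_zero]

/-- Testing on `Bᵏ z` for all `z ∈ ℤⁿ` shows that `{(B*)ᵏ s}` has integer coordinates. Hence `(B*)ᵏ
s` lies in the closure of `ℤⁿ[B*]`, though not necessarily in that of `Γ[B*]`. -/
theorem mem_cl_of_char_eq_one {k : ℤ} {s : Series (transposeGL B)}
    (h : ∀ y ∈ cl (stdLattice n) B k, P.char s y = 1) :
    s ∈ cl (stdLattice n) (transposeGL B) (-k) := by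
  have h1 : fracPart (transposeGL B) F (seriesMul (transposeGL B) k s) ∈ stdLattice n := by
    refine mem_stdLattice_of_dotProduct fun z => ?_
    rw [← ratExp_eq_one_iff, ← P.char_monomial_right]
    exact h _ (monomial_mem_cl_std B k z)
  have h2 := sub_fracPart_mem_cl P.full P.right (seriesMul (transposeGL B) k s)
  have h3 : toSeries (transposeGL B) (ofLaurent (fracPart_mem_laurent P.full P.right
      (seriesMul (transposeGL B) k s))) ∈ cl (stdLattice n) (transposeGL B) 0 := by
    refine toSeries_mem_cl ?_
    rw [gfil_zero, laurentVal_ofLaurent]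
    exact le_poly _ _ h1
  have h4 := add_mem (cl_mono P.full.le_std _ _ h2) h3
  rwa [sub_add_cancel, ← neg_add_cancel k, seriesMul_mem_cl] at h4

/-- Testing against the monomials `(B*)ʲ N z`, with `N ℤⁿ ⊆ Γ`, bounds the denominators of `{Bʲ y}`
by `N` for every `j`. So all `Bʲ y` lie in one fixed subgroup of the filtration, and shifting back
puts `y` in every subgroup. -/
theorem eq_zero_of_char_eq_one {y : Series B} (h : ∀ s, P.char s y = 1) : y = 0 := by
  obtain ⟨N, hN, hNΓ⟩ := P.full.exists_smul
  obtain ⟨m, hm⟩ := exists_fil_of_smul_mem_std B hN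
  have h1 : ∀ j, seriesMul B j y ∈ cl (stdLattice n) B (min m 0) := by
    intro j
    have h2 : (N : ℤ) • fracPart B E (seriesMul B j y) ∈ stdLattice n := by
      refine mem_stdLattice_of_dotProduct fun z => ?_
      have h3 : intVec n ((N : ℤ) • z) ∈ Γ := by
        rw [map_smul]
        exact hNΓ _ (intVec_mem_std z)
      have h4 := h (monomial (transposeGL B) j ((N : ℤ) • z))
      rwa [P.char_monomial_left j h3, map_smul, dotProduct_smul, ← smul_dotProduct,
        dotProduct_comm, ratExp_eq_one_iff] at h4
    have h5 := sub_fracPart_mem_cl isFullSublattice_std P.left (seriesMul B j y)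
    have h6 := toSeries_mem_cl (L := stdLattice n)
      (x := ofLaurent (fracPart_mem_laurent isFullSublattice_std P.left (seriesMul B j y)))
      (hm _ (fracPart_mem_laurent isFullSublattice_std P.left (seriesMul B j y)) h2)
    have h7 := add_mem (cl_antitone _ B (min_le_right m 0) h5)
      (cl_antitone _ B (min_le_left m 0) h6)
    rwa [sub_add_cancel] at h7
  refine eq_zero_of_forall_mem_cl_std fun k => ?_
  rw [← seriesMul_mem_cl (j := min m 0 - k), add_sub_cancel]
  exact h1 _

theorem isDualPairing :
    IsDualPairing (cl (stdLattice n) B) (cl (stdLattice n) (transposeGL B)) P.char where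
  antitone := cl_antitone _ _
  antitone' := cl_antitone _ _
  hasBasis := hasBasis_nhds_zero _
  hasBasis' := hasBasis_nhds_zero _
  isCompact := isCompact_cl_std _
  exists_mem := exists_mem_cl_std
  exists_mem' := exists_mem_cl_std
  map_add := P.char_add
  eq_one := by
    -- The constant is the shift needed to pass from the closure of `ℤⁿ[B*]` to that of `Γ[B*]`,
    -- where triviality holds without a shift.
    obtain ⟨m, hm⟩ := P.full.exists_cl_std_le (transposeGL B)
    exact ⟨m, fun k l hkl s hs y hy => P.adicChar_eq_one (hm l hs) hy (by omega)⟩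
  mem_of_eq_one _ _ := P.mem_cl_of_char_eq_one
  eq_zero _ := P.eq_zero_of_char_eq_one

end IsPairingData

/-! ### Self-duality of `ℝⁿ`. -/

theorem realChar_add_left (r r' x : EuclideanSpace ℝ (Fin n)) :
    realChar (r + r') x = realChar r x * realChar r' x := by
  unfold realChar
  rw [inner_add_right, mul_add, Circle.exp_add]

theorem realChar_add_right (r x x' : EuclideanSpace ℝ (Fin n)) :
    realChar r (x + x') = realChar r x * realChar r x' := by
  unfold realChar
  rw [inner_add_left, mul_add, Circle.exp_add]

theorem realChar_zero_left (x : EuclideanSpace ℝ (Fin n)) : realChar 0 x = 1 := by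
  unfold realChar
  rw [inner_zero_right, mul_zero, Circle.exp_zero]

theorem realChar_zero_right (r : EuclideanSpace ℝ (Fin n)) : realChar r 0 = 1 := by
  unfold realChar
  rw [inner_zero_left, mul_zero, Circle.exp_zero]

theorem continuous_realChar_uncurry :
    Continuous fun p : EuclideanSpace ℝ (Fin n) × EuclideanSpace ℝ (Fin n) => realChar p.1 p.2 :=
  Circle.exp.continuous.comp (continuous_const.mul (continuous_snd.inner continuous_fst))

/-- A character lifts through the covering `ℝ → 𝕋` to a continuous function vanishing at `0`.
Uniqueness of lifts makes it additive, continuity makes it linear, and the Riesz representation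
gives `r` up to the factor `2π`. -/
theorem exists_eq_realChar {ψ : AddChar (EuclideanSpace ℝ (Fin n)) Circle} (hψ : Continuous ψ) :
    ∃ r, ∀ x, realChar r x = ψ x := by
  have hlift := Circle.isCoveringMap_exp.existsUnique_continuousMap_lifts
    (⟨ψ, hψ⟩ : C(EuclideanSpace ℝ (Fin n), Circle)) 0 0
    (by rw [Circle.exp_zero]; exact ψ.map_zero_eq_one.symm)
  obtain ⟨θ, ⟨hθ0, hθ⟩, huniq⟩ := hlift
  have hθ' : ∀ x, Circle.exp (θ x) = ψ x := congrFun hθ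
  have hadd : ∀ x y, θ (x + y) = θ x + θ y := by
    intro x y
    have h1 := huniq ⟨fun x => θ (x + y) - θ y,
      (θ.continuous.comp (continuous_id.add continuous_const)).sub continuous_const⟩ ⟨by simp, by
        funext x
        change Circle.exp (θ (x + y) - θ y) = ψ x
        rw [Circle.exp_sub, hθ', hθ', AddChar.map_add_eq_mul, mul_div_cancel_right]⟩
    have h2 : θ (x + y) - θ y = θ x := DFunLike.congr_fun h1 x
    rw [← h2, sub_add_cancel]
  let f : EuclideanSpace ℝ (Fin n) →+ ℝ :=
    { toFun := θ, map_zero' := hθ0, map_add' := hadd }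
  let g : EuclideanSpace ℝ (Fin n) →L[ℝ] ℝ := f.toRealLinearMap θ.continuous
  let r := (InnerProductSpace.toDual ℝ (EuclideanSpace ℝ (Fin n))).symm g
  refine ⟨(2 * Real.pi)⁻¹ • r, fun x => ?_⟩
  rw [← hθ' x]
  unfold realChar
  rw [inner_smul_right, mul_inv_cancel_left₀ (by positivity), real_inner_comm,
    InnerProductSpace.toDual_symm_apply]
  rfl

theorem norm_lt_of_realChar_mem_centeredArc {r : EuclideanSpace ℝ (Fin n)} {ε : ℝ} (hε : 0 < ε)
    (h : ∀ x ∈ Metric.closedBall (0 : EuclideanSpace ℝ (Fin n)) (2 * ε)⁻¹,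
      realChar r x ∈ Circle.centeredArc (Real.pi / 2)) : ‖r‖ < ε := by
  by_contra! hr
  have hr0 : 0 < ‖r‖ := hε.trans_le hr
  -- This multiple of `r` has inner product `1/2` with `r`, so the character takes the value `-1`;
  -- its norm is `1/(2‖r‖) ≤ 1/(2ε)`.
  have h1 := h ((2 * ‖r‖ ^ 2)⁻¹ • r) (by
    rw [mem_closedBall_zero_iff, norm_smul, Real.norm_of_nonneg (by positivity)]
    have : (2 * ‖r‖ ^ 2)⁻¹ * ‖r‖ = (2 * ‖r‖)⁻¹ := by field_simp
    rw [this]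
    gcongr)
  have h2 : realChar r ((2 * ‖r‖ ^ 2)⁻¹ • r) = Circle.exp Real.pi := by
    unfold realChar
    rw [real_inner_smul_left, real_inner_self_eq_norm_sq]
    congr 1
    field_simp
  rw [h2, Circle.mem_centeredArc (by linarith [Real.pi_pos]), Circle.coe_exp, Complex.exp_pi_mul_I,
    Complex.arg_neg_one, abs_of_pos Real.pi_pos] at h1
  linarith [Real.pi_pos]

/-- `χ_r` as an additive character. -/
def realAddChar (r : EuclideanSpace ℝ (Fin n)) : AddChar (EuclideanSpace ℝ (Fin n)) Circle where
  toFun := realChar r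
  map_zero_eq_one' := realChar_zero_right r
  map_add_eq_mul' := realChar_add_right r

theorem continuous_realAddChar (r : EuclideanSpace ℝ (Fin n)) : Continuous (realAddChar r) :=
  continuous_realChar_uncurry.comp (continuous_const.prodMk continuous_id)

/-- The homomorphism `r ↦ χ_r` from `ℝⁿ` to its Pontryagin dual. -/
def realToDual : Multiplicative (EuclideanSpace ℝ (Fin n)) →*
    PontryaginDual (Multiplicative (EuclideanSpace ℝ (Fin n))) where
  toFun r :=
    ({ toMonoidHom := (realAddChar r.toAdd).toMonoidHom
       continuous_toFun := continuous_realAddChar r.toAdd } :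
      Multiplicative (EuclideanSpace ℝ (Fin n)) →ₜ* Circle)
  map_one' := PontryaginDual.ext fun x => realChar_zero_left x.toAdd
  map_mul' r r' := PontryaginDual.ext fun x => realChar_add_left r.toAdd r'.toAdd x.toAdd

theorem realToDual_apply (r x : Multiplicative (EuclideanSpace ℝ (Fin n))) :
    realToDual r x = realChar r.toAdd x.toAdd := rfl

theorem realToDual_bijective : Function.Bijective (realToDual (n := n)) := by
  constructor
  · rw [injective_iff_map_eq_one]
    intro r hr
    have h1 : ∀ ε > 0, ‖r.toAdd‖ < ε := fun ε hε =>
      norm_lt_of_realChar_mem_centeredArc hε fun x _ => by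
        have h2 : realChar r.toAdd x = 1 := DFunLike.congr_fun hr (Multiplicative.ofAdd x)
        rw [h2, Circle.mem_centeredArc (by linarith [Real.pi_pos])]
        simp [Real.pi_pos]
    have h3 : r.toAdd = 0 := by
      by_contra hne
      exact lt_irrefl _ (h1 _ (norm_pos_iff.2 hne))
    exact h3
  · intro ψ
    obtain ⟨r, hr⟩ := exists_eq_realChar
      (ψ := AddChar.toMonoidHomEquiv.symm
        (ψ : Multiplicative (EuclideanSpace ℝ (Fin n)) →* Circle)) (map_continuous ψ)
    refine ⟨Multiplicative.ofAdd r, ?_⟩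
    ext x
    rw [realToDual_apply, toAdd_ofAdd, hr]
    rfl

/-- The isomorphism of topological groups `r ↦ χ_r` from `ℝⁿ` onto its Pontryagin dual. -/
def realEquivDual : Multiplicative (EuclideanSpace ℝ (Fin n)) ≃ₜ*
    PontryaginDual (Multiplicative (EuclideanSpace ℝ (Fin n))) where
  toMulEquiv := MulEquiv.ofBijective realToDual realToDual_bijective
  continuous_toFun := by
    refine ContinuousMonoidHom.continuous_of_continuous_uncurry realToDual ?_
    exact continuous_realChar_uncurry.comp
      ((continuous_toAdd.comp continuous_fst).prodMk (continuous_toAdd.comp continuous_snd))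
  continuous_invFun := by
    refine continuous_of_continuousAt_one
      (MulEquiv.ofBijective realToDual realToDual_bijective).symm ?_
    rw [ContinuousAt, map_one]
    intro W hW
    obtain ⟨ε, hε, hW⟩ := Metric.nhds_basis_ball.mem_iff.1
      (show Multiplicative.ofAdd ⁻¹' W ∈ 𝓝 (0 : EuclideanSpace ℝ (Fin n)) from hW)
    have hV : {ψ : PontryaginDual (Multiplicative (EuclideanSpace ℝ (Fin n))) | Set.MapsTo ψ
        (Multiplicative.toAdd ⁻¹' Metric.closedBall (0 : EuclideanSpace ℝ (Fin n)) (2 * ε)⁻¹)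
        (Circle.centeredArc (Real.pi / 2))} ∈
        𝓝 (1 : PontryaginDual (Multiplicative (EuclideanSpace ℝ (Fin n)))) := by
      refine IsOpen.mem_nhds ?_ ?_
      · exact isOpen_induced (ContinuousMap.isOpen_setOfPred_mapsTo
          (isCompact_closedBall (0 : EuclideanSpace ℝ (Fin n)) (2 * ε)⁻¹)
          (Circle.isOpen_centeredArc (Real.pi / 2)))
      · intro x _
        rw [PontryaginDual.one_apply, Circle.mem_centeredArc (by linarith [Real.pi_pos])]
        simp [Real.pi_pos]
    refine mem_map.2 (mem_of_superset hV fun ψ hψ => ?_)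
    obtain ⟨r, rfl⟩ := realToDual_bijective.2 ψ
    rw [Set.mem_preimage]
    have hr : (MulEquiv.ofBijective realToDual realToDual_bijective).symm (realToDual r) = r :=
      MulEquiv.symm_apply_apply (MulEquiv.ofBijective realToDual realToDual_bijective) r
    rw [hr]
    exact hW (mem_ball_zero_iff.2
      (norm_lt_of_realChar_mem_centeredArc (r := r.toAdd) hε fun x hx => hψ hx))

/-! ### Duals of products. -/

section Prod

variable {V V' K K' : Type*} [AddCommGroup V] [TopologicalSpace V] [AddCommGroup V']
  [TopologicalSpace V'] [AddCommGroup K] [TopologicalSpace K] [AddCommGroup K']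
  [TopologicalSpace K']

/-- The first projection, multiplicatively. -/
def mulFst : Multiplicative (V × K) →ₜ* Multiplicative V where
  toMonoidHom := AddMonoidHom.toMultiplicative (AddMonoidHom.fst V K)
  continuous_toFun := continuous_fst

/-- The second projection, multiplicatively. -/
def mulSnd : Multiplicative (V × K) →ₜ* Multiplicative K where
  toMonoidHom := AddMonoidHom.toMultiplicative (AddMonoidHom.snd V K)
  continuous_toFun := continuous_snd

/-- The inclusion of the first factor, multiplicatively. -/
def mulInl : Multiplicative V →ₜ* Multiplicative (V × K) where
  toMonoidHom := AddMonoidHom.toMultiplicative (AddMonoidHom.inl V K)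
  continuous_toFun := (continuous_id.prodMk continuous_const : Continuous fun x : V => (x, (0 : K)))

/-- The inclusion of the second factor, multiplicatively. -/
def mulInr : Multiplicative K →ₜ* Multiplicative (V × K) where
  toMonoidHom := AddMonoidHom.toMultiplicative (AddMonoidHom.inr V K)
  continuous_toFun := (continuous_const.prodMk continuous_id : Continuous fun x : K => ((0 : V), x))

/-- The dual of a product is the product of the duals. -/
def prodEquivDual (e : Multiplicative V' ≃ₜ* PontryaginDual (Multiplicative V))
    (f : Multiplicative K' ≃ₜ* PontryaginDual (Multiplicative K)) :
    Multiplicative (V' × K') ≃ₜ* PontryaginDual (Multiplicative (V × K)) where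
  toFun p := PontryaginDual.map mulFst (e (mulFst p)) * PontryaginDual.map mulSnd (f (mulSnd p))
  invFun ψ := mulInl (e.symm (PontryaginDual.map mulInl ψ)) *
    mulInr (f.symm (PontryaginDual.map mulInr ψ))
  left_inv p := by
    have h1 : PontryaginDual.map mulInl (PontryaginDual.map mulFst (e (mulFst p)) *
        PontryaginDual.map mulSnd (f (mulSnd p))) = e (mulFst p) := by
      ext x
      change ((e (mulFst p) x * f (mulSnd p) 1 : Circle) : ℂ) = _
      rw [map_one, mul_one]
    have h2 : PontryaginDual.map mulInr (PontryaginDual.map mulFst (e (mulFst p)) *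
        PontryaginDual.map mulSnd (f (mulSnd p))) = f (mulSnd p) := by
      ext x
      change ((e (mulFst p) 1 * f (mulSnd p) x : Circle) : ℂ) = _
      rw [map_one, one_mul]
    beta_reduce
    rw [h1, h2, ContinuousMulEquiv.symm_apply_apply, ContinuousMulEquiv.symm_apply_apply]
    exact Prod.ext (add_zero _) (zero_add _)
  right_inv ψ := by
    have h1 : ∀ (a : Multiplicative V') (b : Multiplicative K'),
        mulFst (mulInl a * mulInr b) = a := fun a b => add_zero a.toAdd
    have h2 : ∀ (a : Multiplicative V') (b : Multiplicative K'),
        mulSnd (mulInl a * mulInr b) = b := fun a b => zero_add b.toAdd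
    beta_reduce
    rw [h1, h2, ContinuousMulEquiv.apply_symm_apply, ContinuousMulEquiv.apply_symm_apply]
    ext x
    congr 1
    change ψ (mulInl (mulFst x)) * ψ (mulInr (mulSnd x)) = ψ x
    rw [← map_mul]
    exact congrArg ψ (Prod.ext (add_zero _) (zero_add _) :
      (((mulFst x).toAdd, 0) + (0, (mulSnd x).toAdd) : V × K) = x.toAdd)
  map_mul' p q := by
    simp only [map_mul]
    exact mul_mul_mul_comm _ _ _ _
  continuous_toFun :=
    ((map_continuous (PontryaginDual.map mulFst)).comp
      ((map_continuous e).comp (map_continuous mulFst))).mul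
    ((map_continuous (PontryaginDual.map mulSnd)).comp
      ((map_continuous f).comp (map_continuous mulSnd)))
  continuous_invFun := by
    have h1 := (map_continuous e.symm).comp
      (map_continuous (PontryaginDual.map (mulInl : Multiplicative V →ₜ* Multiplicative (V × K))))
    have h2 := (map_continuous f.symm).comp
      (map_continuous (PontryaginDual.map (mulInr : Multiplicative K →ₜ* Multiplicative (V × K))))
    refine (continuous_ofAdd.comp ((continuous_toAdd.comp h1).prodMk
      (continuous_toAdd.comp h2))).congr fun ψ => ?_
    exact (Prod.ext (add_zero _) (zero_add _)).symm

end Prod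

/-! ### Characters as elements of the dual, and the main theorem. -/

theorem isCharacter_iff_exists_pontryaginDual {G : Type*} [AddCommGroup G] [TopologicalSpace G]
    {χ : G → Circle} :
    IsCharacter χ ↔ ∃ ψ : PontryaginDual (Multiplicative G),
      ∀ x, ψ (Multiplicative.ofAdd x) = χ x := by
  constructor
  · rintro ⟨hc, hadd⟩
    refine ⟨({ toFun := fun x => χ x.toAdd
               map_one' := ?_
               map_mul' := fun x y => hadd _ _
               continuous_toFun := hc.comp continuous_toAdd } : Multiplicative G →ₜ* Circle),
      fun x => rfl⟩
    have := hadd 0 0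
    rwa [add_zero, left_eq_mul] at this
  · rintro ⟨ψ, hψ⟩
    refine ⟨((map_continuous ψ).comp continuous_ofAdd).congr hψ, fun x y => ?_⟩
    rw [← hψ, ← hψ, ← hψ, ofAdd_add, map_mul]

end RationalTile

end

theorem mainTheorem7 {n : ℕ} (A : GL (Fin n) ℚ)
    (hA : RationalTile.IsExpanding (A : Matrix (Fin n) (Fin n) ℚ))
    (L Γ : Submodule ℤ (Fin n → ℚ)) (hL : Submodule.IsLattice ℚ L) (hΓ : Submodule.IsLattice ℚ Γ)
    (hAL : RationalTile.poly (RationalTile.stdLattice n) A ⊓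
      RationalTile.poly (RationalTile.stdLattice n) A⁻¹ ≤ L)
    (hΓL : RationalTile.poly Γ (RationalTile.transposeGL A) ⊓
      RationalTile.poly Γ (RationalTile.transposeGL A⁻¹) ≤ RationalTile.dualLattice L)
    (E F : Set (Fin n → ℤ))
    (hE : RationalTile.IsResidueSystem (RationalTile.stdLattice n) A⁻¹ E)
    (hF : RationalTile.IsResidueSystem Γ (RationalTile.transposeGL A⁻¹) F) :
    -- the expansions exist and are unique, and the sum `S_s(y)` has finitely many nonzero terms
    (∀ y : RationalTile.Series A⁻¹, ∃! d, RationalTile.IsExpansion A⁻¹ E y d) ∧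
    (∀ s : RationalTile.Series (RationalTile.transposeGL A⁻¹),
      ∃! d, RationalTile.IsExpansion (RationalTile.transposeGL A⁻¹) F s d) ∧
    (∀ (s : RationalTile.Series (RationalTile.transposeGL A⁻¹)) (y : RationalTile.Series A⁻¹),
      {j : ℤ | RationalTile.fracPart A⁻¹ E (RationalTile.seriesMul A⁻¹ j y) ≠ 0 ∧
        RationalTile.digits (RationalTile.transposeGL A⁻¹) F s j ≠ 0}.Finite) ∧
    -- the characters of the representation space are exactly the `χ_{r,s}`
    (∀ χ : RationalTile.RepSpace A → Circle, RationalTile.IsCharacter χ ↔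
      ∃ (r : EuclideanSpace ℝ (Fin n)) (s : RationalTile.Series (RationalTile.transposeGL A⁻¹)),
        ∀ x y, χ (x, y) = RationalTile.realChar r x * RationalTile.adicChar A⁻¹ E F s y) ∧
    -- `(r, s) ↦ χ_{r,s}` is an isomorphism of topological groups onto the dual
    (∃ Φ : Multiplicative (EuclideanSpace ℝ (Fin n) ×
          RationalTile.Series (RationalTile.transposeGL A⁻¹)) ≃ₜ*
        PontryaginDual (Multiplicative (RationalTile.RepSpace A)),
      ∀ r s x y, Φ (Multiplicative.ofAdd (r, s)) (Multiplicative.ofAdd (x, y)) =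
        RationalTile.realChar r x * RationalTile.adicChar A⁻¹ E F s y) ∧
    -- `s ↦ χ_s` is an isomorphism of topological groups onto the dual
    (∃ Ψ : Multiplicative (RationalTile.Series (RationalTile.transposeGL A⁻¹)) ≃ₜ*
        PontryaginDual (Multiplicative (RationalTile.Series A⁻¹)),
      ∀ s y, Ψ (Multiplicative.ofAdd s) (Multiplicative.ofAdd y) =
        RationalTile.adicChar A⁻¹ E F s y) := by
  -- `Γ` lies in both groups of the intersection, and the dual lattice consists of integer vectors
  -- by definition.
  have hΓstd : Γ ≤ RationalTile.stdLattice n := fun x hx =>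
    (hΓL ⟨RationalTile.le_poly Γ _ hx, RationalTile.le_poly Γ _ hx⟩).1
  have P : RationalTile.IsPairingData A⁻¹ Γ E F :=
    { full := ⟨hΓstd, RationalTile.exists_smul_std_mem_of_span_eq_top hΓ.span_eq_top⟩
      left := hE
      right := hF
      integral := by
        rw [inv_inv, RationalTile.transposeGL_inv_inv]
        intro u hu v hv
        -- The only use of `Λ` in the pairing: it contains the left intersection, and its dual
        -- contains the right one.
        obtain ⟨m, hm⟩ := (hΓL hv).2 u (hAL hu)
        exact ⟨m, by rw [dotProduct_comm, hm]⟩ }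
  have hΦ : ∃ Φ : Multiplicative (EuclideanSpace ℝ (Fin n) ×
          RationalTile.Series (RationalTile.transposeGL A⁻¹)) ≃ₜ*
        PontryaginDual (Multiplicative (RationalTile.RepSpace A)),
      ∀ r s x y, Φ (Multiplicative.ofAdd (r, s)) (Multiplicative.ofAdd (x, y)) =
        RationalTile.realChar r x * RationalTile.adicChar A⁻¹ E F s y :=
    ⟨RationalTile.prodEquivDual RationalTile.realEquivDual P.isDualPairing.equivDual,
      fun _ _ _ _ => rfl⟩
  refine ⟨RationalTile.existsUnique_isExpansion RationalTile.isFullSublattice_std hE,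
    RationalTile.existsUnique_isExpansion P.full hF, fun s y => ?_, fun χ => ?_, hΦ,
    P.isDualPairing.equivDual, fun _ _ => rfl⟩
  · obtain ⟨l, hs⟩ := P.full.exists_mem_cl s
    obtain ⟨k, hy⟩ := RationalTile.exists_mem_cl_std y
    exact (Finset.finite_toSet _).subset (P.support_pairing_subset hs hy)
  · obtain ⟨Φ, hΦ⟩ := hΦ
    rw [RationalTile.isCharacter_iff_exists_pontryaginDual]
    constructor
    · rintro ⟨ψ, hψ⟩
      obtain ⟨p, rfl⟩ := Φ.surjective ψ
      exact ⟨p.toAdd.1, p.toAdd.2, fun x y => by rw [← hψ, ← hΦ]; rfl⟩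
    · rintro ⟨r, s, h⟩
      exact ⟨Φ (Multiplicative.ofAdd (r, s)), fun ⟨x, y⟩ => by rw [hΦ, h]⟩
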